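/- **Conventions.** Boolean functions take values in $\{-1,1\}$, where $-1$ stands for "true" and $1$ for "false". A function $f\colon\{0,1\}^n\to\{-1,1\}$ is a *halfspace* if there are reals $\alpha_1,\dots,\alpha_n,\theta$ with $f(x)=\operatorname{sign}\left(\sum_{i=1}^n\alpha_i x_i-\theta\right)$ for all $x\in\{0,1\}^n$, where $\operatorname{sign} t$ is $-1$, $0$, $1$ for $t<0$, $t=0$, $t>0$, respectively. The majority function $\mathrm{MAJ}_n\colon\{0,1\}^n\to\{-1,1\}$ equals $-1$ if $x_1+\cdots+x_n>n/2$ and $1$ otherwise. For $f\colon\{0,1\}^m\to\{-1,1\}$ and $g\colon\{0,1\}^n\to\{-1,1\}$, the conjunction $f\wedge g\colon\{0,1\}^{m}\times\{0,1\}^{n}\to\{-1,1\}$ is taken on disjoint sets of variables: $(f\wedge g)(x,y)=-1$ if $f(x)=g(y)=-1$, and $(f\wedge g)(x,y)=1$ otherwise. For $S\subseteq\{1,\dots,n\}$ let $\chi_S(x)=(-1)^{\sum_{i\in S}x_i}$. The *threshold density* $\mathrm{dns}(f)$ of $f\colon\{0,1\}^n\to\{-1,1\}$ is the minimum size $|\mathcal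 S|$ of a family $\mathcal S$ of subsets of $\{1,\dots,n\}$ such that, for some reals $\lambda_S$ $(S\in\mathcal S)$, one has $f(x)=\operatorname{sign}\left(\sum_{S\in\mathcal S}\lambda_S\chi_S(x)\right)$ for all $x\in\{0,1\}^n$. **Theorem.** There exist a family of halfspaces $h_n\colon\{0,1\}^n\to\{-1,1\}$, $n=1,2,3,\dots$, and absolute constants $c_1,c_2>0$ such that for every integer $n\ge1$, $$\mathrm{dns}(h_n\wedge h_n)\ \ge\ \exp\{c_1 n\},\qquad \mathrm{dns}(h_n\wedge \mathrm{MAJ}_n)\ \ge\ \exp\left\{c_2\sqrt{n\log_2 n}\right\}.$$ -/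

import Mathlib

noncomputable section

namespace ThresholdDensity

/-- A point of the Boolean cube `{0,1}^ι` is a map `ι → Bool`; this is its `i`-th coordinate,
read as the real number `0` or `1`. -/
def bit {ι : Type*} (x : ι → Bool) (i : ι) : ℝ := ((x i).toNat : ℝ)

/-- A Boolean function `{0,1}^ι → {-1,1}`. The value `-1` stands for "true" and the value `1`
for "false". -/
abbrev BoolFun (ι : Type*) : Type _ := (ι → Bool) → ℤˣ

/-- `f` is sign-represented by the real function `p`: `f(x) = sign p(x)` for every `x`, where
`Real.sign` is `-1`, `0`, `1` on negative numbers, zero, positive numbers respectively. -/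
def SignRep {ι : Type*} (f : BoolFun ι) (p : (ι → Bool) → ℝ) : Prop :=
  ∀ x, ((f x : ℤ) : ℝ) = Real.sign (p x)

/-- `f` is a halfspace: `f(x) = sign (∑ αᵢ xᵢ - θ)` for some reals `αᵢ`, `θ`. -/
def IsHalfspace {ι : Type*} [Fintype ι] (f : BoolFun ι) : Prop :=
  ∃ (α : ι → ℝ) (θ : ℝ), SignRep f (fun x => ∑ i, α i * bit x i - θ)

/-- The majority function on `{0,1}^n`: true (`-1`) iff `x₁ + ⋯ + xₙ > n / 2`. -/
def maj (n : ℕ) : BoolFun (Fin n) :=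
  fun x => if (n : ℝ) / 2 < ∑ i, bit x i then -1 else 1

/-- The conjunction `(f ∧ g)(x, y) = f(x) ∧ g(y)` of two Boolean functions on disjoint sets of
variables. A pair in `{0,1}^ι × {0,1}^κ` is read as a point of `{0,1}^(ι ⊕ κ)`. -/
def conj {ι κ : Type*} (f : BoolFun ι) (g : BoolFun κ) : BoolFun (ι ⊕ κ) :=
  fun z => if f (fun i => z (Sum.inl i)) = -1 ∧ g (fun j => z (Sum.inr j)) = -1 then -1 else 1

/-- The parity function (character) `χ_S(x) = (-1)^(∑_{i ∈ S} xᵢ)`. -/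
def chi {ι : Type*} (S : Finset ι) (x : ι → Bool) : ℝ :=
  (-1) ^ (∑ i ∈ S, (x i).toNat)

/-- The threshold density of `f`: the minimum size of a family `𝒮` of subsets of the set of
variables such that `f` is sign-represented by a real linear combination of the parity functions
`χ_S`, `S ∈ 𝒮`. Since the parity functions span all real functions on the cube, the minimum is
over a nonempty set. -/
def dns {ι : Type*} (f : BoolFun ι) : ℕ :=
  sInf {k : ℕ | ∃ 𝒮 : Finset (Finset ι), 𝒮.card = k ∧
    ∃ c : Finset ι → ℝ, SignRep f (fun x => ∑ S ∈ 𝒮, c S * chi S x)}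

end ThresholdDensity

end

noncomputable section

namespace ThresholdDensity

/-! The proof has three layers. First, density is reduced to degree: if `F` restricts to `f` on
every filling of four-variable blocks (`IsLift`), a random choice of halves followed by averaging
kills each character that stays of high degree, so `dns F < 2 ^ d` gives `f` a sign-representation
of degree at most `d` (`exists_lowDeg_signRep_of_dns_lt`).

Second, degree is reduced to univariate polynomials. The hard halfspace is the sign of a subset sum
minus `M` times a carry count. For suitable weights modulo `M = 2 ^ q`, every residue class carries
a distribution that fools all characters of degree at most `q` (`exists_fooling_weights`). Setting
the linear form equal to `t` through such a distribution makes low-degree averages polynomial in `t`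
for all nonzero `|t| < 2 ^ q` (`resolves_carry`). So the halfspace reaches exponentially large `t`,
whereas majority reaches only `|t|` of order `n` (`resolves_aboveLevel`). A sign-representation of a
conjunction thus averages to `P(s, t)`, of degree at most `d` in each variable separately and
negative exactly when both arguments are negative (`card_le_of_signRep_conj`).

Third, such a `P` needs large degree. The total of `|log |p(-a) / p(a)||` over a grid is at most the
degree times the contribution of one root, which is bounded both on the grid of powers of 2 and on a
harmonically weighted interval. So `P(s, t)` and `P(s, -t)` have bounded log-ratio for most grid
points. For a typical fixed `t` the ratio is then close to one of few values `e ^ k` for most `s`,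
and `P(s, t) - e ^ k P(s, -t)` is small at such `s` but not at `-s`, where the two terms reinforce.
Each such `s` costs a constant amount of log-ratio, which bounds the grid size
(`card_le_of_sign_pattern`). Two geometric grids of size `q` give `d` linear in `n`; a geometric and
a harmonic grid give `d ^ 2` of order `n log n`. -/

open Polynomial

/-! ### Truncated log-ratios of polynomials at opposite points -/

/-- The distance between `log |x|` and `log |y|`, truncated at `V`. -/
def logDist (V x y : ℝ) : ℝ :=
  if x = 0 ∨ y = 0 then V else min V |Real.log x - Real.log y|

lemma logDist_nonneg {V : ℝ} (hV : 0 ≤ V) (x y : ℝ) : 0 ≤ logDist V x y := by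
  unfold logDist
  split_ifs
  · exact hV
  · exact le_min hV (abs_nonneg _)

lemma logDist_le {V : ℝ} (x y : ℝ) : logDist V x y ≤ V := by
  unfold logDist
  split_ifs
  · exact le_rfl
  · exact min_le_left _ _

lemma logDist_abs_abs (V x y : ℝ) : logDist V |x| |y| = logDist V x y := by
  simp [logDist, Real.log_abs]

lemma logDist_neg_left (V x y : ℝ) : logDist V (-x) y = logDist V x y := by
  simp [logDist]

/-- The triangle inequality survives truncation. Giving zeros the maximal value `V` removes every
nonvanishing assumption, so roots on the grid need no separate treatment. -/
lemma logDist_mul_le {V : ℝ} (hV : 0 ≤ V) (x y x' y' : ℝ) :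
    logDist V (x * x') (y * y') ≤ logDist V x y + logDist V x' y' := by
  by_cases h : x = 0 ∨ y = 0
  · have : logDist V x y = V := by simp [logDist, h]
    linarith [logDist_le (V := V) (x * x') (y * y'), logDist_nonneg hV x' y']
  by_cases h' : x' = 0 ∨ y' = 0
  · have : logDist V x' y' = V := by simp [logDist, h']
    linarith [logDist_le (V := V) (x * x') (y * y'), logDist_nonneg hV x y]
  push Not at h h'
  have e : Real.log (x * x') - Real.log (y * y') =
      (Real.log x - Real.log y) + (Real.log x' - Real.log y') := by
    rw [Real.log_mul h.1 h'.1, Real.log_mul h.2 h'.2]; ring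
  simp only [logDist, h.1, h.2, h'.1, h'.2, mul_eq_zero, or_self, if_false, e]
  have := abs_add_le (Real.log x - Real.log y) (Real.log x' - Real.log y')
  have h1 := abs_nonneg (Real.log x - Real.log y)
  have h2 := abs_nonneg (Real.log x' - Real.log y')
  rcases min_cases V |Real.log x - Real.log y| with ⟨a, _⟩ | ⟨a, _⟩ <;>
  rcases min_cases V |Real.log x' - Real.log y'| with ⟨b, _⟩ | ⟨b, _⟩ <;>
  rw [a, b] <;>
  first
  | (exact (min_le_left _ _).trans (by linarith))
  | (exact (min_le_right _ _).trans (by linarith))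

lemma logDist_self {V : ℝ} (hV : 0 ≤ V) {x : ℝ} (hx : x ≠ 0) : logDist V x x = 0 := by
  simp [logDist, hx, hV]

lemma logDist_multiset_prod_le {V : ℝ} (hV : 0 ≤ V) {α : Type*} (s : Multiset α) (f g : α → ℝ) :
    logDist V (s.map f).prod (s.map g).prod ≤ (s.map fun a => logDist V (f a) (g a)).sum := by
  induction s using Multiset.induction_on with
  | empty => simp [logDist_self hV one_ne_zero]
  | cons a s ih =>
    simp only [Multiset.map_cons, Multiset.prod_cons, Multiset.sum_cons]
    exact (logDist_mul_le hV _ _ _ _).trans (by linarith)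

/-- Among all complex `z` of modulus `r`, the real ones distort `|a + z| / |a - z|` most. -/
lemma logDist_norm_le {V a : ℝ} (ha : 0 < a) (z : ℂ) :
    logDist V ‖-(a : ℂ) - z‖ ‖(a : ℂ) - z‖ ≤ logDist V (a + ‖z‖) (a - ‖z‖) := by
  have hz := norm_nonneg z
  by_cases h : a - ‖z‖ = 0
  · rw [show logDist V (a + ‖z‖) (a - ‖z‖) = V by simp [logDist, h]]
    exact logDist_le _ _
  have e1 : ‖-(a : ℂ) - z‖ = ‖(a : ℂ) + z‖ := by rw [← norm_neg]; ring_nf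
  have l1 : |a - ‖z‖| ≤ ‖(a : ℂ) + z‖ := by
    have := abs_norm_sub_norm_le (a : ℂ) (-z); simpa [abs_of_pos ha] using this
  have l2 : |a - ‖z‖| ≤ ‖(a : ℂ) - z‖ := by
    have := abs_norm_sub_norm_le (a : ℂ) z; simpa [abs_of_pos ha] using this
  have u1 : ‖(a : ℂ) + z‖ ≤ a + ‖z‖ := by simpa [abs_of_pos ha] using norm_add_le (a : ℂ) z
  have u2 : ‖(a : ℂ) - z‖ ≤ a + ‖z‖ := by simpa [abs_of_pos ha] using norm_sub_le (a : ℂ) z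
  have p : 0 < |a - ‖z‖| := abs_pos.2 h
  have p1 := p.trans_le l1
  have p2 := p.trans_le l2
  have g1 := Real.log_le_log p l1
  have g2 := Real.log_le_log p l2
  have g3 := Real.log_le_log p1 u1
  have g4 := Real.log_le_log p2 u2
  rw [Real.log_abs] at g1 g2
  rw [e1]
  have hne : a + ‖z‖ ≠ 0 := by positivity
  simp only [logDist, p1.ne', p2.ne', h, hne, or_self, if_false]
  refine min_le_min_left _ ?_
  rw [abs_of_nonneg (by linarith : 0 ≤ Real.log (a + ‖z‖) - Real.log (a - ‖z‖))]
  exact abs_le.2 ⟨by linarith, by linarith⟩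

lemma abs_eval_eq_prod_roots (p : ℝ[X]) (x : ℝ) :
    |p.eval x| = |p.leadingCoeff| *
      (((p.map (algebraMap ℝ ℂ)).roots).map fun z => ‖(x : ℂ) - z‖).prod := by
  set P := p.map (algebraMap ℝ ℂ)
  have hs : P.Splits := IsAlgClosed.splits P
  have h1 : P.eval (x : ℂ) = ((p.eval x : ℝ) : ℂ) := by
    have := Polynomial.eval_map_algebraMap (B := ℂ) p (x : ℂ)
    rw [this]
    exact (Polynomial.aeval_algebraMap_apply_eq_algebraMap_eval (A := ℂ) x p)
  have h2 := hs.eval_eq_prod_roots (x : ℂ)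
  rw [h1] at h2
  have h3 := congrArg norm h2
  rw [norm_mul] at h3
  have h4 : ‖((p.eval x : ℝ) : ℂ)‖ = |p.eval x| := by simp
  rw [h4] at h3
  rw [h3]
  congr 1
  · simp [P, leadingCoeff_map]
  · induction P.roots using Multiset.induction_on with
    | empty => simp
    | cons a s ih => simp [ih]

/-- Factor `p` over `ℂ` and use subadditivity: the leading coefficient cancels, and each root `z`
contributes no more than a real root of modulus `‖z‖`, hence at most `E` over the whole grid. -/
lemma sum_logDist_eval_le {J : Type*} (s : Finset J) (a w : J → ℝ) (ha : ∀ j ∈ s, 0 < a j)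
    (hw : ∀ j ∈ s, 0 ≤ w j) {V E : ℝ} (hV : 0 ≤ V)
    (hE : ∀ r : ℝ, 0 ≤ r → ∑ j ∈ s, w j * logDist V (a j + r) (a j - r) ≤ E)
    (p : ℝ[X]) (hp : p ≠ 0) :
    ∑ j ∈ s, w j * logDist V (p.eval (-a j)) (p.eval (a j)) ≤ p.natDegree * E := by
  set R := (p.map (algebraMap ℝ ℂ)).roots
  have hcard : R.card = p.natDegree := by
    have := (IsAlgClosed.splits (p.map (algebraMap ℝ ℂ))).natDegree_eq_card_roots
    rw [← this, natDegree_map]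
  have hl : |p.leadingCoeff| ≠ 0 := by simpa using hp
  have key : ∀ j ∈ s, logDist V (p.eval (-a j)) (p.eval (a j)) ≤
      (R.map fun z => logDist V (a j + ‖z‖) (a j - ‖z‖)).sum := by
    intro j hj
    rw [← logDist_abs_abs, abs_eval_eq_prod_roots, abs_eval_eq_prod_roots]
    refine (logDist_mul_le hV _ _ _ _).trans ?_
    rw [logDist_self hV hl, zero_add]
    refine (logDist_multiset_prod_le hV _ _ _).trans ?_
    refine Multiset.sum_map_le_sum_map _ _ fun z _ => ?_
    have := logDist_norm_le (V := V) (ha j hj) z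
    push_cast
    exact this
  calc ∑ j ∈ s, w j * logDist V (p.eval (-a j)) (p.eval (a j))
      ≤ ∑ j ∈ s, w j * (R.map fun z => logDist V (a j + ‖z‖) (a j - ‖z‖)).sum :=
        Finset.sum_le_sum fun j hj => mul_le_mul_of_nonneg_left (key j hj) (hw j hj)
    _ = (R.map fun z => ∑ j ∈ s, w j * logDist V (a j + ‖z‖) (a j - ‖z‖)).sum := by
        clear_value R
        clear key hcard
        induction R using Multiset.induction_on with
        | empty => simp
        | cons z R ih => simp [mul_add, Finset.sum_add_distrib, ih]
    _ ≤ R.card • E := by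
        have := Multiset.sum_le_card_nsmul
          (R.map fun z => ∑ j ∈ s, w j * logDist V (a j + ‖z‖) (a j - ‖z‖)) E (by
            intro x hx
            obtain ⟨z, _, rfl⟩ := Multiset.mem_map.1 hx
            exact hE _ (norm_nonneg z))
        simpa using this
    _ = p.natDegree * E := by rw [hcard, nsmul_eq_mul]

/-! ### The contribution of one root on geometric and harmonic grids -/

/-- The logarithm of `|(a + r) / (a - r)|` in terms of the gap `|a - r|`. -/
lemma logDist_le_log {V a r : ℝ} (ha : 0 < a) (hr : 0 ≤ r) (h : a ≠ r) :
    logDist V (a + r) (a - r) ≤ Real.log (1 + 2 * min a r / |a - r|) := by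
  have h1 : a + r ≠ 0 := by positivity
  have h2 : a - r ≠ 0 := sub_ne_zero.2 h
  have p : 0 < |a - r| := abs_pos.2 h2
  simp only [logDist, h1, h2, or_self, if_false]
  refine (min_le_right _ _).trans ?_
  have e : 1 + 2 * min a r / |a - r| = (a + r) / |a - r| := by
    rw [eq_div_iff p.ne', add_mul, div_mul_cancel₀ _ p.ne', one_mul]
    rcases le_total a r with h | h
    · rw [min_eq_left h, abs_of_nonpos (by linarith)]; ring
    · rw [min_eq_right h, abs_of_nonneg (by linarith)]; ring
  rw [e, Real.log_div h1 p.ne', Real.log_abs]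
  have : Real.log |a - r| ≤ Real.log (a + r) := by
    apply Real.log_le_log p
    rw [abs_le]; constructor <;> linarith
  rw [Real.log_abs] at this
  rw [abs_of_nonneg (by linarith)]

/-- The right side is of order `min a r / max a r`, the rate at which the log-ratio decays away from
`a = r`; truncation handles `a / 2 ≤ r ≤ 2 a`... its form as a difference between `2 a` and `a`
telescopes over powers of 2. -/
lemma logDist_one_le_ratio {a r : ℝ} (ha : 0 < a) (hr : 0 ≤ r) :
    logDist 1 (a + r) (a - r) ≤ 24 * (2 * a / (2 * a + r) - a / (a + r)) := by
  have hd : 0 < 2 * a + r := by positivity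
  have hd' : 0 < a + r := by positivity
  have e : 24 * (2 * a / (2 * a + r) - a / (a + r)) = 24 * (a * r) / ((2 * a + r) * (a + r)) := by
    field_simp; ring
  rw [e]
  by_cases h : 2 * r < a ∨ 2 * a < r
  · have hne : a ≠ r := by rintro rfl; rcases h with h | h <;> linarith
    have p : 0 < |a - r| := abs_pos.2 (sub_ne_zero.2 hne)
    refine (logDist_le_log ha hr hne).trans ?_
    have hx : 0 ≤ 2 * min a r / |a - r| := by positivity
    have := Real.log_le_sub_one_of_pos (show 0 < 1 + 2 * min a r / |a - r| by positivity)
    refine (this.trans (le_of_eq (by ring : _ = 2 * min a r / |a - r|))).trans ?_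
    rw [div_le_div_iff₀ p (by positivity)]
    rcases h with h | h
    · rw [min_eq_right (by linarith), abs_of_pos (by linarith)]
      nlinarith [mul_nonneg hr ha.le, mul_nonneg hr hr, mul_nonneg (mul_nonneg hr ha.le) (by linarith : 0 ≤ a - 2 * r), mul_nonneg (mul_nonneg hr hr) (by linarith : 0 ≤ a - 2 * r)]
    · rw [min_eq_left (by linarith), abs_of_neg (by linarith)]
      nlinarith [mul_nonneg hr ha.le, mul_nonneg hr hr, mul_nonneg (mul_nonneg hr ha.le) (by linarith : 0 ≤ r - 2 * a), mul_nonneg (mul_nonneg ha.le ha.le) (by linarith : 0 ≤ r - 2 * a)]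
  · push Not at h
    refine (logDist_le _ _).trans ?_
    rw [le_div_iff₀ (by positivity)]
    nlinarith [mul_nonneg (by linarith [h.1] : 0 ≤ 2 * r - a) (by linarith [h.2] : 0 ≤ 2 * a - r)]

/-- On the geometric grid `1, 2, 4, …` a single root distorts `|p(-a) / p(a)|` boundedly. -/
lemma sum_logDist_geometric (K : ℕ) {r : ℝ} (hr : 0 ≤ r) :
    ∑ i ∈ Finset.range K, 1 * logDist 1 ((2 : ℝ) ^ i + r) ((2 : ℝ) ^ i - r) ≤ 24 := by
  have h : ∀ i ∈ Finset.range K, 1 * logDist 1 ((2 : ℝ) ^ i + r) ((2 : ℝ) ^ i - r) ≤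
      24 * ((2 : ℝ) ^ (i + 1) / (2 ^ (i + 1) + r)) - 24 * ((2 : ℝ) ^ i / (2 ^ i + r)) := by
    intro i _
    have := logDist_one_le_ratio (a := (2 : ℝ) ^ i) (by positivity) hr
    rw [one_mul, pow_succ']
    linarith
  refine (Finset.sum_le_sum h).trans ?_
  rw [Finset.sum_range_sub (fun i => 24 * ((2 : ℝ) ^ i / (2 ^ i + r)))]
  have h1 : (2 : ℝ) ^ K / (2 ^ K + r) ≤ 1 := by
    rw [div_le_one (by positivity)]; linarith
  have h2 : 0 ≤ (2 : ℝ) ^ 0 / (2 ^ 0 + r) := by positivity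
  linarith

lemma inv_sqrt_le {x : ℝ} (hx : 1 ≤ x) : 1 / √x ≤ 2 * (√x - √(x - 1)) := by
  have h0 : 0 < √x := Real.sqrt_pos.2 (by linarith)
  have h1 := Real.sq_sqrt (by linarith : 0 ≤ x)
  have h2 := Real.sq_sqrt (by linarith : 0 ≤ x - 1)
  rw [div_le_iff₀ h0]
  nlinarith [sq_nonneg (√x - √(x - 1))]

/-- Uses `log (1 + s ^ 2) ≤ s`, which follows from the cubic Taylor bound for `exp s`. An inverse
square root singularity at `a = r` is still summable at unit spacing. -/
lemma logDist_le_sqrt {V a r : ℝ} (ha : 0 < a) (hr : 0 ≤ r) (h : a ≠ r) :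
    logDist V (a + r) (a - r) ≤ √(2 * min a r / |a - r|) := by
  have p : 0 < |a - r| := abs_pos.2 (sub_ne_zero.2 h)
  refine (logDist_le_log ha hr h).trans ?_
  set x := 2 * min a r / |a - r|
  have hx : 0 ≤ x := by positivity
  rw [Real.log_le_iff_le_exp (by positivity)]
  have hs := Real.sq_sqrt hx
  have h0 := Real.sqrt_nonneg x
  have h1 := Real.sum_le_exp_of_nonneg h0 4
  simp only [Finset.sum_range_succ, Finset.sum_range_zero, Nat.factorial] at h1
  norm_num at h1
  nlinarith [mul_nonneg h0 (sq_nonneg (√x - 3 / 2))]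

/-- The square-root bound is a multiple of `1 / (√t √(r - t))`, and `√r ≤ √t + √(r - t)` splits it
into two inverse square roots, each dominated by an increment of a square root. -/
lemma weighted_logDist_left {V t r : ℝ} (ht : 1 ≤ t) (hr : t ≤ r - 1) :
    1 / t * logDist V (t + r) (t - r) ≤
      4 / √r * (√(r - t) - √(r - (t + 1))) + 4 / √r * (√t - √(t - 1)) := by
  have hr0 : 0 < r := by linarith
  have hgap : 0 < r - t := by linarith
  have hsr : 0 < √r := Real.sqrt_pos.2 hr0
  have h := logDist_le_sqrt (V := V) (a := t) (r := r) (by linarith) hr0.le (by linarith)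
  rw [min_eq_left (by linarith), abs_of_neg (by linarith), neg_sub] at h
  have i1 := inv_sqrt_le (x := r - t) (by linarith)
  have i2 := inv_sqrt_le (x := t) ht
  rw [show r - t - 1 = r - (t + 1) by ring] at i1
  have hst : 0 < √t := Real.sqrt_pos.2 (by linarith)
  have hsg : 0 < √(r - t) := Real.sqrt_pos.2 hgap
  have key : 1 / t * √(2 * t / (r - t)) ≤ 2 / √r * (1 / √(r - t) + 1 / √t) := by
    rw [Real.sqrt_div (by linarith), Real.sqrt_mul (by norm_num)]
    have e1 := Real.sq_sqrt (by linarith : 0 ≤ t)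
    have e2 := Real.sq_sqrt hgap.le
    have e3 := Real.sq_sqrt hr0.le
    have e4 : √2 ≤ 2 := by
      rw [Real.sqrt_le_left (by norm_num)]; norm_num
    have lhs : 1 / t * (√2 * √t / √(r - t)) = √2 / (√t * √(r - t)) := by
      nth_rewrite 1 [← e1]; field_simp
    have rhs : 2 / √r * (1 / √(r - t) + 1 / √t) = 2 * (√t + √(r - t)) / √r / (√t * √(r - t)) := by
      field_simp
    rw [lhs, rhs]
    refine div_le_div_of_nonneg_right ?_ (by positivity)
    rw [le_div_iff₀ hsr]
    have : √r ≤ √t + √(r - t) := by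
      refine (pow_le_pow_iff_left₀ hsr.le (by positivity) two_ne_zero).1 ?_
      nlinarith [mul_pos hst hsg]
    nlinarith
  calc 1 / t * logDist V (t + r) (t - r) ≤ 1 / t * √(2 * t / (r - t)) :=
        mul_le_mul_of_nonneg_left h (by positivity)
    _ ≤ _ := key
    _ ≤ 2 / √r * (2 * (√(r - t) - √(r - (t + 1))) + 2 * (√t - √(t - 1))) :=
        mul_le_mul_of_nonneg_left (by linarith) (by positivity)
    _ = _ := by ring

/-- With `x = √(t - r)`, the function `x / (x + √r)` is bounded by 1 and its unit increments in `t`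
dominate the square-root bound, so the infinite tail sums to a constant. -/
lemma weighted_logDist_right {V t r : ℝ} (hr0 : 0 < r) (hr : r + 1 ≤ t) :
    1 / t * logDist V (t + r) (t - r) ≤
      8 * (√(t - r) / (√(t - r) + √r) - √(t - 1 - r) / (√(t - 1 - r) + √r)) := by
  have hgap : 0 < t - r := by linarith
  have ht : 0 < t := by linarith
  have hsr : 0 < √r := Real.sqrt_pos.2 hr0
  have h := logDist_le_sqrt (V := V) (a := t) (r := r) ht hr0.le (by linarith)
  rw [min_eq_right (by linarith), abs_of_pos hgap] at h
  have i1 := inv_sqrt_le (x := t - r) (by linarith)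
  rw [show t - r - 1 = t - 1 - r by ring] at i1
  set x := √(t - r)
  set y := √(t - 1 - r)
  have hx : 0 < x := Real.sqrt_pos.2 hgap
  have hy : 0 ≤ y := Real.sqrt_nonneg _
  have hyx : y ≤ x := Real.sqrt_le_sqrt (by linarith)
  have e1 : x ^ 2 = t - r := Real.sq_sqrt hgap.le
  have e3 := Real.sq_sqrt hr0.le
  have e4 : √2 ≤ 2 := by
    rw [Real.sqrt_le_left (by norm_num)]; norm_num
  have lhs : 1 / t * √(2 * r / (t - r)) = √2 * √r / (t * x) := by
    rw [Real.sqrt_div (by linarith), Real.sqrt_mul (by norm_num)]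
    field_simp
    rfl
  have rhs : 8 * (x / (x + √r) - y / (y + √r)) = 8 * (√r * (x - y)) / ((x + √r) * (y + √r)) := by
    field_simp; ring
  calc 1 / t * logDist V (t + r) (t - r) ≤ 1 / t * √(2 * r / (t - r)) :=
        mul_le_mul_of_nonneg_left h (by positivity)
    _ = √2 * √r / (t * x) := lhs
    _ ≤ 8 * (√r * (x - y)) / ((x + √r) * (y + √r)) := by
        have hq : (x + √r) * (y + √r) ≤ 2 * t := by
          nlinarith [sq_nonneg (x - √r), mul_nonneg (sub_nonneg.2 hyx) hx.le,
            mul_nonneg (sub_nonneg.2 hyx) hsr.le]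
        have hxy : 1 ≤ 2 * (x - y) * x := by
          rw [div_le_iff₀ hx] at i1; exact i1
        have hpos : 0 < (x + √r) * (y + √r) := by positivity
        rw [div_le_div_iff₀ (by positivity) hpos]
        calc √2 * √r * ((x + √r) * (y + √r)) ≤ 2 * √r * (2 * t) := by
              gcongr
          _ ≤ 8 * (√r * t) * (2 * (x - y) * x) / 2 := by nlinarith [mul_pos hsr ht]
          _ = _ := by ring
    _ = _ := rhs.symm

/-- On the harmonic grid `T, T + 1, …, R - 1` with weights `1 / t` a single root distorts
`|p(-t) / p(t)|` boundedly. -/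
lemma sum_logDist_harmonic {T R : ℕ} (hT : 1 ≤ T) (hTR : T ≤ R) {V r : ℝ} (hV : 0 ≤ V) (hVT : V ≤ T)
    (hr : 0 ≤ r) :
    ∑ t ∈ Finset.Ico T R, 1 / (t : ℝ) * logDist V (t + r) (t - r) ≤ 18 := by
  have hT' : (1 : ℝ) ≤ T := by exact_mod_cast hT
  rcases hr.eq_or_lt with rfl | hr0
  · have : ∀ t ∈ Finset.Ico T R, 1 / (t : ℝ) * logDist V (t + 0) (t - 0) ≤ 0 := by
      intro t ht
      have : (t : ℝ) ≠ 0 := by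
        have := (Finset.mem_Ico.1 ht).1
        exact_mod_cast (by omega : t ≠ 0)
      simp [logDist_self hV this]
    exact (Finset.sum_nonpos this).trans (by norm_num)
  have hsr : 0 < √r := Real.sqrt_pos.2 hr0
  -- Since `√` vanishes on negative reals and `min` caps `f2`, all three potentials are monotone on
  -- the whole range, so every term may be charged with all three increments. Their total growth is
  -- at most 4, 4 and 8; the at most two `t` with `|t - r| < 1` cost at most `V / t ≤ 1` each.
  set f1 : ℕ → ℝ := fun t => -(4 / √r * √(r - t))
  set f2 : ℕ → ℝ := fun t => 4 / √r * √(min ((t : ℝ) - 1) r)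
  set f3 : ℕ → ℝ := fun t => 8 * (√((t : ℝ) - 1 - r) / (√((t : ℝ) - 1 - r) + √r))
  have hc : 0 ≤ 4 / √r := by positivity
  have m1 : ∀ t, 0 ≤ f1 (t + 1) - f1 t := by
    intro t
    have : √(r - (t + 1 : ℕ)) ≤ √(r - t) := Real.sqrt_le_sqrt (by push_cast; linarith)
    have := mul_le_mul_of_nonneg_left this hc
    simp only [f1]; linarith
  have m2 : ∀ t, 0 ≤ f2 (t + 1) - f2 t := by
    intro t
    have : √(min ((t : ℝ) - 1) r) ≤ √(min (((t + 1 : ℕ) : ℝ) - 1) r) :=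
      Real.sqrt_le_sqrt (min_le_min_right _ (by push_cast; linarith))
    have := mul_le_mul_of_nonneg_left this hc
    simp only [f2]; linarith
  have m3 : ∀ t, 0 ≤ f3 (t + 1) - f3 t := by
    intro t
    have h : √((t : ℝ) - 1 - r) ≤ √(((t + 1 : ℕ) : ℝ) - 1 - r) :=
      Real.sqrt_le_sqrt (by push_cast; linarith)
    have : √((t : ℝ) - 1 - r) / (√((t : ℝ) - 1 - r) + √r) ≤
        √(((t + 1 : ℕ) : ℝ) - 1 - r) / (√(((t + 1 : ℕ) : ℝ) - 1 - r) + √r) := by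
      rw [div_le_div_iff₀ (by positivity) (by positivity)]
      nlinarith
    simp only [f3]; linarith
  have term : ∀ t ∈ Finset.Ico T R, 1 / (t : ℝ) * logDist V (t + r) (t - r) ≤
      ((f1 (t + 1) - f1 t) + (f2 (t + 1) - f2 t) + (f3 (t + 1) - f3 t)) +
        if |(t : ℝ) - r| < 1 then 1 else 0 := by
    intro t ht
    have ht1 : (T : ℝ) ≤ t := by exact_mod_cast (Finset.mem_Ico.1 ht).1
    split_ifs with hnear
    · have : 1 / (t : ℝ) * logDist V (t + r) (t - r) ≤ 1 := by
        rw [one_div, inv_mul_le_iff₀ (by linarith)]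
        linarith [logDist_le (V := V) (t + r) (t - r)]
      linarith [m1 t, m2 t, m3 t]
    · rw [not_lt] at hnear
      rcases le_abs.1 hnear with h | h
      · have := weighted_logDist_right (V := V) hr0 (by linarith : r + 1 ≤ t)
        have e : f3 (t + 1) - f3 t = 8 * (√(t - r) / (√(t - r) + √r) -
            √(t - 1 - r) / (√(t - 1 - r) + √r)) := by
          simp only [f3]; push_cast; ring_nf
        linarith [m1 t, m2 t]
      · have := weighted_logDist_left (V := V) (by linarith : 1 ≤ (t : ℝ)) (by linarith : t ≤ r - 1)
        have e1 : f1 (t + 1) - f1 t = 4 / √r * (√(r - t) - √(r - (t + 1))) := by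
          simp only [f1]; push_cast; ring
        have e2 : f2 (t + 1) - f2 t = 4 / √r * (√t - √(t - 1)) := by
          simp only [f2]; push_cast
          rw [min_eq_left (by linarith), min_eq_left (by linarith)]; ring_nf
        linarith [m3 t]
  refine (Finset.sum_le_sum term).trans ?_
  have near : ∑ t ∈ Finset.Ico T R, (if |(t : ℝ) - r| < 1 then (1 : ℝ) else 0) ≤ 2 := by
    rw [Finset.sum_boole]
    have : (Finset.Ico T R).filter (fun t : ℕ => |(t : ℝ) - r| < 1) ⊆ {⌊r⌋₊, ⌊r⌋₊ + 1} := by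
      intro t ht
      have h := abs_lt.1 (Finset.mem_filter.1 ht).2
      have a := Nat.floor_le hr
      have b := Nat.lt_floor_add_one r
      have c : ⌊r⌋₊ < t + 1 := by
        have : (⌊r⌋₊ : ℝ) < t + 1 := by linarith
        exact_mod_cast this
      have d : t < ⌊r⌋₊ + 2 := by
        have : (t : ℝ) < ⌊r⌋₊ + 2 := by linarith
        exact_mod_cast this
      simp; omega
    have := (Finset.card_le_card this).trans Finset.card_le_two
    exact_mod_cast this
  rw [Finset.sum_add_distrib, Finset.sum_add_distrib, Finset.sum_add_distrib,
    Finset.sum_Ico_sub _ hTR, Finset.sum_Ico_sub _ hTR, Finset.sum_Ico_sub _ hTR]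
  have b1 : f1 R - f1 T ≤ 4 := by
    have h1 : √(r - T) ≤ √r := Real.sqrt_le_sqrt (by linarith)
    have h2 : 4 / √r * √(r - T) ≤ 4 / √r * √r := mul_le_mul_of_nonneg_left h1 hc
    rw [div_mul_cancel₀ _ hsr.ne'] at h2
    have h3 : 0 ≤ 4 / √r * √(r - R) := by positivity
    simp only [f1]; linarith
  have b2 : f2 R - f2 T ≤ 4 := by
    have h1 : √(min ((R : ℝ) - 1) r) ≤ √r := Real.sqrt_le_sqrt (min_le_right _ _)
    have h2 := mul_le_mul_of_nonneg_left h1 hc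
    rw [div_mul_cancel₀ _ hsr.ne'] at h2
    have h3 : 0 ≤ f2 T := by simp only [f2]; positivity
    simp only [f2] at h3 ⊢; linarith
  have b3 : f3 R - f3 T ≤ 8 := by
    have h1 : √((R : ℝ) - 1 - r) / (√((R : ℝ) - 1 - r) + √r) ≤ 1 := by
      rw [div_le_one (by positivity)]; linarith
    have h3 : 0 ≤ f3 T := by simp only [f3]; positivity
    simp only [f3] at h3 ⊢; linarith
  linarith

/-! ### The sign pattern of a conjunction forces large degree -/

/-- If `a / b` is close to `e ^ u` and `a', b'` are close to `a, b`, then `a - e ^ u * b` is much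
smaller than `a' + e ^ u * b'`. -/
lemma logDist_combination {a b a' b' u : ℝ} (ha : 0 < a) (hb : 0 < b) (ha' : 0 < a') (hb' : 0 < b')
    (h : |Real.log a - Real.log b - u| ≤ 1 / 2) :
    1 / 4 ≤ logDist 1 a' a + logDist 1 b' b +
      logDist 1 (a' + Real.exp u * b') (a - Real.exp u * b) := by
  by_contra! hlt
  have n1 := logDist_nonneg zero_le_one a' a
  have n2 := logDist_nonneg zero_le_one b' b
  have n3 := logDist_nonneg zero_le_one (a' + Real.exp u * b') (a - Real.exp u * b)
  have hu := Real.exp_pos u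
  have hD' : 0 < a' + Real.exp u * b' := by positivity
  have hD : a - Real.exp u * b ≠ 0 := by
    intro h0
    have : logDist 1 (a' + Real.exp u * b') (a - Real.exp u * b) = 1 := by simp [logDist, h0]
    linarith
  have ext : ∀ x y : ℝ, 0 < x → y ≠ 0 → logDist 1 x y < 1 / 4 →
      |Real.log x - Real.log y| < 1 / 4 := by
    intro x y hx hy hxy
    simp only [logDist, hx.ne', hy, or_self, if_false] at hxy
    rcases min_lt_iff.1 hxy with h | h
    · norm_num at h
    · exact h
  have k1 := abs_lt.1 (ext a' a ha' ha.ne' (by linarith))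
  have k2 := abs_lt.1 (ext b' b hb' hb.ne' (by linarith))
  have k3 := abs_lt.1 (ext _ _ hD' hD (by linarith))
  have lower : ∀ x y : ℝ, 0 < x → 0 < y → Real.log x - Real.log y < 1 / 4 →
      x < Real.exp (1 / 4) * y := by
    intro x y hx hy h
    rw [← Real.log_lt_log_iff hx (by positivity), Real.log_mul (Real.exp_pos _).ne' hy.ne',
      Real.log_exp]
    linarith
  have j1 := lower a a' ha ha' (by linarith [k1.1])
  have j2 := lower b b' hb hb' (by linarith [k2.1])
  have j3 := lower _ |a - Real.exp u * b| hD' (abs_pos.2 hD) (by rw [Real.log_abs]; linarith [k3.2])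
  have hh := abs_le.1 h
  have j4 : a ≤ Real.exp (1 / 2) * (Real.exp u * b) := by
    rw [← Real.log_le_log_iff ha (by positivity), Real.log_mul (by positivity) (by positivity),
      Real.log_mul (by positivity) hb.ne', Real.log_exp, Real.log_exp]
    linarith
  have j5 : Real.exp u * b ≤ Real.exp (1 / 2) * a := by
    rw [← Real.log_le_log_iff (by positivity) (by positivity), Real.log_mul (by positivity) hb.ne',
      Real.log_mul (by positivity) ha.ne', Real.log_exp, Real.log_exp]
    linarith
  have esq : Real.exp (1 / 4) ^ 2 = Real.exp (1 / 2) := by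
    rw [← Real.exp_nat_mul]; norm_num
  have ebd : Real.exp (1 / 2) < 1.7 := by
    have h1 : Real.exp (1 / 2) ^ 2 = Real.exp 1 := by rw [← Real.exp_nat_mul]; norm_num
    have := Real.exp_one_lt_d9
    nlinarith [Real.exp_pos (1 / 2)]
  set q := Real.exp (1 / 4)
  set c := Real.exp u * b
  have hc : 0 < c := by positivity
  have hq : 0 < q := Real.exp_pos _
  have sum : a + c < q * (a' + Real.exp u * b') := by nlinarith
  have : a + c < q ^ 2 * |a - c| := by nlinarith
  rw [esq] at this
  -- Now `a + c < 1.7 |a - c|`, whereas `a` and `c` are within a factor 1.7 of each other, so `|a -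
  -- c|` is at most 0.7 times the smaller one.
  rcases abs_cases (a - c) with ⟨e, _⟩ | ⟨e, _⟩ <;> rw [e] at this <;> nlinarith

/-- A function with the sign pattern of a conjunction on the grid `±a i`, `±τ j` cannot be
polynomial of small degree in each variable. -/
theorem card_le_of_sign_pattern {I J : Type*} (s : Finset I) (a : I → ℤ) (u : Finset J) (τ : J → ℤ)
    (w : J → ℝ) (hw : ∀ j ∈ u, 0 ≤ w j) (hW : 0 < ∑ j ∈ u, w j) (P : ℤ → ℤ → ℝ) {d V : ℕ} {Es Et : ℝ}
    (hV : 1 ≤ V)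
    (hneg : ∀ i ∈ s, ∀ j ∈ u, P (-a i) (-τ j) < 0) (hpp : ∀ i ∈ s, ∀ j ∈ u, 0 < P (a i) (τ j))
    (hpn : ∀ i ∈ s, ∀ j ∈ u, 0 < P (a i) (-τ j)) (hnp : ∀ i ∈ s, ∀ j ∈ u, 0 < P (-a i) (τ j))
    (hPs : ∀ j ∈ u, ∀ σ : ℤ, σ = τ j ∨ σ = -τ j → ∃ p : ℝ[X], p.natDegree ≤ d ∧ ∀ i ∈ s,
      P (a i) σ = p.eval (a i : ℝ) ∧ P (-a i) σ = p.eval (-(a i : ℝ)))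
    (hPt : ∀ i ∈ s, ∃ p : ℝ[X], p.natDegree ≤ d ∧ ∀ j ∈ u,
      P (a i) (τ j) = p.eval (τ j : ℝ) ∧ P (a i) (-τ j) = p.eval (-(τ j : ℝ)))
    (hEs : ∀ p : ℝ[X], p ≠ 0 → p.natDegree ≤ d →
      ∑ i ∈ s, logDist 1 (p.eval (-(a i : ℝ))) (p.eval (a i : ℝ)) ≤ Es)
    (hEt : ∀ p : ℝ[X], p ≠ 0 → p.natDegree ≤ d →
      ∑ j ∈ u, w j * logDist V (p.eval (-(τ j : ℝ))) (p.eval (τ j : ℝ)) ≤ Et)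
    (hVE : 4 * Et ≤ V * ∑ j ∈ u, w j) :
    (s.card : ℝ) ≤ 16 * (2 * V + 1) * Es := by
  classical
  set W := ∑ j ∈ u, w j
  have hV0 : (0 : ℝ) < V := by exact_mod_cast hV
  have hune : u.Nonempty := by
    by_contra h
    rw [Finset.not_nonempty_iff_eq_empty] at h
    simp [W, h] at hW
  let v : I → J → ℝ := fun i j => Real.log (P (a i) (τ j)) - Real.log (P (a i) (-τ j))
  let far : I → J → ℝ := fun i j => if |v i j| < V then 0 else 1
  -- Markov's inequality in each row: a far entry costs the full truncation value `V`, and the whole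
  -- row costs at most `Et ≤ V W / 4`.
  have hrow : ∀ i ∈ s, ∑ j ∈ u, w j * far i j ≤ W / 4 := by
    intro i hi
    obtain ⟨p, hpd, hp⟩ := hPt i hi
    have hp0 : p ≠ 0 := by
      rintro rfl
      obtain ⟨j, hj⟩ := hune
      have := hpp i hi j hj
      rw [(hp j hj).1] at this
      simp at this
    have h1 := hEt p hp0 hpd
    have h2 : V * ∑ j ∈ u, w j * far i j ≤
        ∑ j ∈ u, w j * logDist V (p.eval (-(τ j : ℝ))) (p.eval (τ j : ℝ)) := by
      rw [Finset.mul_sum]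
      refine Finset.sum_le_sum fun j hj => ?_
      rw [mul_left_comm]
      refine mul_le_mul_of_nonneg_left ?_ (hw j hj)
      simp only [far]
      split_ifs with hfar
      · simpa using logDist_nonneg hV0.le _ _
      · rw [mul_one, ← (hp j hj).1, ← (hp j hj).2, logDist]
        simp only [(hpp i hi j hj).ne', (hpn i hi j hj).ne', or_self, if_false]
        rw [abs_sub_comm, min_eq_left (not_lt.1 hfar)]
    have h3 : V * ∑ j ∈ u, w j * far i j ≤ V * (W / 4) := by linarith
    exact le_of_mul_le_mul_left h3 hV0
  -- By weighted averaging some column has at most a quarter of its entries far. From here on this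
  -- column is fixed.
  obtain ⟨j, hj, hcol⟩ : ∃ j ∈ u, ∑ i ∈ s, far i j ≤ s.card / 4 := by
    by_contra! hcon
    have h1 : ∑ j ∈ u, w j * (s.card / 4 : ℝ) < ∑ j ∈ u, w j * ∑ i ∈ s, far i j := by
      obtain ⟨j, hj, hwj⟩ := Finset.exists_lt_of_sum_lt (s := u) (f := fun _ => (0 : ℝ)) (g := w)
        (by simpa using hW)
      exact Finset.sum_lt_sum (fun j hj => mul_le_mul_of_nonneg_left (hcon j hj).le (hw j hj))
        ⟨j, hj, mul_lt_mul_of_pos_left (hcon j hj) hwj⟩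
    have h2 : ∑ j ∈ u, w j * ∑ i ∈ s, far i j = ∑ i ∈ s, ∑ j ∈ u, w j * far i j := by
      simp only [Finset.mul_sum]
      exact Finset.sum_comm
    have h3 := Finset.sum_le_card_nsmul s (fun i => ∑ j ∈ u, w j * far i j) (W / 4) hrow
    rw [← Finset.sum_mul, h2] at h1
    rw [nsmul_eq_mul] at h3
    have : W * (s.card / 4 : ℝ) = s.card * (W / 4) := by ring
    linarith
  obtain ⟨p, hpd, hp⟩ := hPs j hj (τ j) (Or.inl rfl)
  obtain ⟨p', hpd', hp'⟩ := hPs j hj (-τ j) (Or.inr rfl)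
  let near : ℤ → Finset I := fun k => s.filter fun i => |v i j - k| ≤ 1 / 2
  have hnear : ∀ k : ℤ, ((near k).card : ℝ) ≤ 12 * Es := by
    intro k
    rcases s.eq_empty_or_nonempty with rfl | ⟨i₀, hi₀⟩
    · have := hEs 1 one_ne_zero (by simp)
      simpa [near] using this
    -- At `-a i` the signs of `p` and `p'` are opposite and the two terms of `D` add up; at `a i`
    -- with `i ∈ near k` they nearly cancel. Each such `i` costs at least 1/4 among `p`, `p'` and
    -- `D`, whose joint budget is `3 * Es`.
    set D := p - C (Real.exp k) * p'
    have hDd : D.natDegree ≤ d := by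
      refine (natDegree_sub_le _ _).trans (max_le hpd ?_)
      exact (natDegree_C_mul_le _ _).trans hpd'
    have hDpos : ∀ i ∈ s, 0 < D.eval (-(a i : ℝ)) := by
      intro i hi
      simp only [D, eval_sub, eval_mul, eval_C, ← (hp i hi).2, ← (hp' i hi).2]
      have := mul_neg_of_pos_of_neg (Real.exp_pos (k : ℝ)) (hneg i hi j hj)
      linarith [hnp i hi j hj]
    have hD0 : D ≠ 0 := by
      intro h
      have := hDpos i₀ hi₀
      simp [h] at this
    have hp0 : p ≠ 0 := by
      rintro rfl
      have := hpp i₀ hi₀ j hj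
      rw [(hp i₀ hi₀).1] at this
      simp at this
    have hp0' : p' ≠ 0 := by
      rintro rfl
      have := hpn i₀ hi₀ j hj
      rw [(hp' i₀ hi₀).1] at this
      simp at this
    have e1 := hEs p hp0 hpd
    have e2 := hEs p' hp0' hpd'
    have e3 := hEs D hD0 hDd
    have hterm : ∑ i ∈ near k, (1 / 4 : ℝ) ≤
        ∑ i ∈ s, (logDist 1 (p.eval (-(a i : ℝ))) (p.eval (a i : ℝ)) +
          logDist 1 (p'.eval (-(a i : ℝ))) (p'.eval (a i : ℝ)) +
          logDist 1 (D.eval (-(a i : ℝ))) (D.eval (a i : ℝ))) := by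
      refine le_trans (Finset.sum_le_sum fun i hi => ?_)
        (Finset.sum_le_sum_of_subset_of_nonneg (Finset.filter_subset _ s) fun i _ _ => ?_)
      · obtain ⟨hi, hik⟩ := Finset.mem_filter.1 hi
        have := logDist_combination (hpp i hi j hj) (hpn i hi j hj) (hnp i hi j hj)
          (neg_pos.2 (hneg i hi j hj)) hik
        rw [logDist_neg_left, (hp i hi).1, (hp i hi).2, (hp' i hi).1, (hp' i hi).2] at this
        simp only [D, eval_sub, eval_mul, eval_C]
        rwa [mul_neg, ← sub_eq_add_neg] at this
      · exact add_nonneg (add_nonneg (logDist_nonneg zero_le_one _ _)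
          (logDist_nonneg zero_le_one _ _)) (logDist_nonneg zero_le_one _ _)
    rw [Finset.sum_add_distrib, Finset.sum_add_distrib, Finset.sum_const, nsmul_eq_mul] at hterm
    linarith
  have hcover : s.filter (fun i => |v i j| < V) ⊆ (Finset.Icc (-(V : ℤ)) V).biUnion near := by
    intro i hi
    obtain ⟨hi, hv⟩ := Finset.mem_filter.1 hi
    have hv := abs_lt.1 hv
    have hr := abs_le.1 (abs_sub_round (v i j))
    refine Finset.mem_biUnion.2 ⟨round (v i j), Finset.mem_Icc.2 ?_,
      Finset.mem_filter.2 ⟨hi, abs_sub_round _⟩⟩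
    constructor
    · have : (-(V : ℤ) : ℝ) < (round (v i j) + 1 : ℤ) := by push_cast; linarith
      have := Int.cast_lt.1 (by exact_mod_cast this : ((-(V : ℤ) : ℤ) : ℝ) < (round (v i j) + 1 : ℤ))
      omega
    · have : ((round (v i j) : ℤ) : ℝ) < ((V + 1 : ℤ) : ℝ) := by push_cast; linarith
      have := Int.cast_lt.1 this
      omega
  have hcount : ((s.filter (fun i => |v i j| < V)).card : ℝ) ≤ (2 * V + 1) * (12 * Es) := by
    have h1 := (Finset.card_le_card hcover).trans Finset.card_biUnion_le
    have h2 : (((Finset.Icc (-(V : ℤ)) V).card : ℕ) : ℝ) = 2 * V + 1 := by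
      rw [Int.card_Icc]
      have : ((V : ℤ) + 1 - -(V : ℤ)).toNat = 2 * V + 1 := by omega
      rw [this]; push_cast; ring
    calc ((s.filter (fun i => |v i j| < V)).card : ℝ)
        ≤ ∑ k ∈ Finset.Icc (-(V : ℤ)) V, ((near k).card : ℝ) := by exact_mod_cast h1
      _ ≤ (Finset.Icc (-(V : ℤ)) V).card • (12 * Es) :=
          Finset.sum_le_card_nsmul _ _ _ fun k _ => hnear k
      _ = _ := by rw [nsmul_eq_mul, h2]
  have hsplit : (s.card : ℝ) = (s.filter (fun i => |v i j| < V)).card + ∑ i ∈ s, far i j := by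
    have e : ∑ i ∈ s, far i j = (s.filter (fun i => ¬ |v i j| < V)).card := by
      simp only [far]
      rw [Finset.sum_ite, Finset.sum_const_zero, zero_add, Finset.sum_const, nsmul_eq_mul, mul_one]
    rw [e]
    exact_mod_cast (Finset.card_filter_add_card_filter_not (s := s) (fun i => |v i j| < V)).symm
  -- The near classes number `2 V + 1` and the far entries at most `s.card / 4`; absorbing the
  -- latter turns 12 into 16.
  linarith

/-! ### Characters, threshold density and low-degree functions -/

/-- The sign `(-1) ^ b` of a bit. -/
def bitSign (b : Bool) : ℝ := if b then -1 else 1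

lemma bitSign_mul_self (b : Bool) : bitSign b * bitSign b = 1 := by cases b <;> simp [bitSign]

lemma chi_eq_prod {ι : Type*} (S : Finset ι) (x : ι → Bool) : chi S x = ∏ i ∈ S, bitSign (x i) := by
  rw [chi, ← Finset.prod_pow_eq_pow_sum]
  refine Finset.prod_congr rfl fun i _ => ?_
  cases x i <;> simp [bitSign]

lemma chi_empty {ι : Type*} (x : ι → Bool) : chi (∅ : Finset ι) x = 1 := by simp [chi]

lemma chi_mul_self {ι : Type*} (S : Finset ι) (x : ι → Bool) : chi S x * chi S x = 1 := by
  rw [chi_eq_prod, ← Finset.prod_mul_distrib]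
  exact Finset.prod_eq_one fun i _ => bitSign_mul_self _

lemma abs_chi {ι : Type*} (S : Finset ι) (x : ι → Bool) : |chi S x| = 1 := by
  have h := chi_mul_self S x
  have h2 : |chi S x| * |chi S x| = 1 := by rw [← abs_mul, h, abs_one]
  nlinarith [abs_nonneg (chi S x)]

lemma chi_mul_chi {ι : Type*} [DecidableEq ι] (S T : Finset ι) (x : ι → Bool) :
    chi S x * chi T x = chi (symmDiff S T) x := by
  have h1 : chi S x = chi (S \ T) x * chi (S ∩ T) x := by
    simp only [chi_eq_prod]
    rw [mul_comm, Finset.prod_inter_mul_prod_sdiff]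
  have h2 : chi T x = chi (T \ S) x * chi (S ∩ T) x := by
    simp only [chi_eq_prod]
    rw [mul_comm, Finset.inter_comm, Finset.prod_inter_mul_prod_sdiff]
  have h3 : chi (symmDiff S T) x = chi (S \ T) x * chi (T \ S) x := by
    simp only [chi_eq_prod]
    rw [symmDiff_def, Finset.sup_eq_union, Finset.prod_union disjoint_sdiff_sdiff]
  rw [h1, h2, h3]
  linear_combination chi (S \ T) x * chi (T \ S) x * chi_mul_self (S ∩ T) x

lemma chi_sumElim {α β : Type*} (T : Finset (α ⊕ β)) (x : α → Bool) (y : β → Bool) :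
    chi T (Sum.elim x y) = chi T.toLeft x * chi T.toRight y := by
  simp only [chi_eq_prod]
  conv_lhs => rw [← Finset.toLeft_disjSum_toRight (u := T)]
  rw [Finset.prod_disjSum]
  simp

/-- Orthogonality of the characters, summed over all characters. -/
lemma sum_chi_mul_chi {ι : Type*} [Fintype ι] [DecidableEq ι] (x y : ι → Bool) :
    ∑ S : Finset ι, chi S x * chi S y = if x = y then 2 ^ Fintype.card ι else 0 := by
  have h : ∑ S : Finset ι, chi S x * chi S y = ∏ i, (1 + bitSign (x i) * bitSign (y i)) := by
    rw [Finset.prod_one_add, Finset.powerset_univ]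
    refine Finset.sum_congr rfl fun S _ => ?_
    rw [chi_eq_prod, chi_eq_prod, Finset.prod_mul_distrib]
  rw [h]
  split_ifs with hxy
  · subst hxy
    simp only [bitSign_mul_self]
    norm_num
  · obtain ⟨i, hi⟩ := Function.ne_iff.1 hxy
    refine Finset.prod_eq_zero (Finset.mem_univ i) ?_
    revert hi
    cases x i <;> cases y i <;> simp [bitSign]

/-- Every real function on the cube is a linear combination of characters. -/
lemma exists_chi_expansion {ι : Type*} [Fintype ι] (g : (ι → Bool) → ℝ) :
    ∃ c : Finset ι → ℝ, ∀ x, g x = ∑ S, c S * chi S x := by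
  classical
  refine ⟨fun S => (∑ y, g y * chi S y) / 2 ^ Fintype.card ι, fun x => ?_⟩
  have : ∑ S, (∑ y, g y * chi S y) / 2 ^ Fintype.card ι * chi S x =
      (∑ y, g y * ∑ S, chi S y * chi S x) / 2 ^ Fintype.card ι := by
    rw [Finset.sum_div]
    simp only [Finset.mul_sum, Finset.sum_div, Finset.sum_mul]
    rw [Finset.sum_comm]
    refine Finset.sum_congr rfl fun y _ => Finset.sum_congr rfl fun S _ => by ring
  rw [this]
  simp [sum_chi_mul_chi]

lemma sign_boolFun {ι : Type*} (f : BoolFun ι) (x : ι → Bool) :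
    Real.sign ((f x : ℤ) : ℝ) = ((f x : ℤ) : ℝ) := by
  rcases Int.units_eq_one_or (f x) with h | h <;> simp [h, Real.sign_of_neg]

/-- The minimum in the definition of the threshold density is attained. -/
lemma exists_card_eq_dns {ι : Type*} [Fintype ι] (f : BoolFun ι) :
    ∃ 𝒮 : Finset (Finset ι), 𝒮.card = dns f ∧
      ∃ c : Finset ι → ℝ, SignRep f (fun x => ∑ S ∈ 𝒮, c S * chi S x) := by
  have hne : {k : ℕ | ∃ 𝒮 : Finset (Finset ι), 𝒮.card = k ∧
    ∃ c : Finset ι → ℝ, SignRep f (fun x => ∑ S ∈ 𝒮, c S * chi S x)}.Nonempty := by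
    classical
    obtain ⟨c, hc⟩ := exists_chi_expansion (fun x => ((f x : ℤ) : ℝ))
    refine ⟨_, Finset.univ, rfl, c, fun x => ?_⟩
    dsimp only
    rw [← hc x, sign_boolFun]
  exact Nat.sInf_mem hne

lemma SignRep.pos_of_eq_one {ι : Type*} {f : BoolFun ι} {p : (ι → Bool) → ℝ} (h : SignRep f p)
    {x : ι → Bool} (hx : f x = 1) : 0 < p x := by
  have := h x
  rw [hx] at this
  rcases lt_trichotomy (p x) 0 with h' | h' | h'
  · rw [Real.sign_of_neg h'] at this; norm_num at this
  · rw [h', Real.sign_zero] at this; norm_num at this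
  · exact h'

lemma SignRep.neg_of_eq_neg_one {ι : Type*} {f : BoolFun ι} {p : (ι → Bool) → ℝ} (h : SignRep f p)
    {x : ι → Bool} (hx : f x = -1) : p x < 0 := by
  have := h x
  rw [hx] at this
  rcases lt_trichotomy (p x) 0 with h' | h' | h'
  · exact h'
  · rw [h', Real.sign_zero] at this; norm_num at this
  · rw [Real.sign_of_pos h'] at this; norm_num at this

lemma signRep_of {ι : Type*} {f : BoolFun ι} {p : (ι → Bool) → ℝ} (h1 : ∀ x, f x = 1 → 0 < p x)
    (h2 : ∀ x, f x = -1 → p x < 0) : SignRep f p := by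
  intro x
  rcases Int.units_eq_one_or (f x) with h | h
  · rw [Real.sign_of_pos (h1 x h), h]; simp
  · rw [Real.sign_of_neg (h2 x h), h]; simp

/-- A conjunction of two nonconstant functions is not a single character up to sign. -/
theorem two_le_dns_conj {ι κ : Type*} [Fintype ι] [Fintype κ] (f : BoolFun ι) (g : BoolFun κ)
    (hf : ∃ x, f x = -1) (hf' : ∃ x, f x = 1) (hg : ∃ x, g x = -1) (hg' : ∃ x, g x = 1) :
    2 ≤ dns (conj f g) := by
  obtain ⟨x, hx⟩ := hf
  obtain ⟨x', hx'⟩ := hf'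
  obtain ⟨y, hy⟩ := hg
  obtain ⟨y', hy'⟩ := hg'
  obtain ⟨𝒮, hcard, c, hc⟩ := exists_card_eq_dns (conj f g)
  by_contra! hlt
  have n1 := hc.neg_of_eq_neg_one (x := Sum.elim x y) (by simp [conj, hx, hy])
  have p1 := hc.pos_of_eq_one (x := Sum.elim x y') (by simp [conj, hx, hy'])
  have p2 := hc.pos_of_eq_one (x := Sum.elim x' y) (by simp [conj, hx', hy])
  have p3 := hc.pos_of_eq_one (x := Sum.elim x' y') (by simp [conj, hx', hy'])
  rw [← hcard] at hlt
  obtain ⟨S, hS⟩ : ∃ S, 𝒮 = {S} := by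
    rw [← Finset.card_eq_one]
    have : 𝒮.card ≠ 0 := by
      intro h
      rw [Finset.card_eq_zero] at h
      simp [h] at n1
    omega
  simp only [hS, Finset.sum_singleton, chi_sumElim] at n1 p1 p2 p3
  -- A single character is a product of a function of `x` and one of `y`, so the two diagonal
  -- products on a rectangle agree; one negative and three positive corners contradict this.
  have a1 := mul_pos p1 p2
  have a2 := mul_neg_of_neg_of_pos n1 p3
  have : c S * (chi S.toLeft x * chi S.toRight y') * (c S * (chi S.toLeft x' * chi S.toRight y)) =
    c S * (chi S.toLeft x * chi S.toRight y) * (c S * (chi S.toLeft x' * chi S.toRight y')) := by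
    ring
  linarith

/-- The space of real functions on the cube of degree at most `d`. -/
def lowDeg (ι : Type*) (d : ℕ) : Submodule ℝ ((ι → Bool) → ℝ) :=
  Submodule.span ℝ {g | ∃ T : Finset ι, T.card ≤ d ∧ g = chi T}

lemma chi_mem_lowDeg {ι : Type*} {d : ℕ} {T : Finset ι} (h : T.card ≤ d) :
    (chi T : (ι → Bool) → ℝ) ∈ lowDeg ι d :=
  Submodule.subset_span ⟨T, h, rfl⟩

lemma mul_mem_lowDeg {ι : Type*} {d e : ℕ} {f g : (ι → Bool) → ℝ} (hf : f ∈ lowDeg ι d)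
    (hg : g ∈ lowDeg ι e) : f * g ∈ lowDeg ι (d + e) := by
  classical
  induction hf using Submodule.span_induction with
  | mem f hf =>
    obtain ⟨S, hS, rfl⟩ := hf
    induction hg using Submodule.span_induction with
    | mem g hg =>
      obtain ⟨T, hT, rfl⟩ := hg
      have : (chi S * chi T : (ι → Bool) → ℝ) = chi (symmDiff S T) := by
        ext x; exact chi_mul_chi S T x
      rw [this]
      refine chi_mem_lowDeg ?_
      calc (symmDiff S T).card ≤ (S ∪ T).card := Finset.card_le_card (by
            rw [← Finset.sup_eq_union]; exact symmDiff_le_sup)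
        _ ≤ S.card + T.card := Finset.card_union_le _ _
        _ ≤ d + e := by omega
    | zero => simp
    | add a b _ _ ha hb => rw [mul_add]; exact add_mem ha hb
    | smul r a _ ha => rw [mul_smul_comm]; exact Submodule.smul_mem _ _ ha
  | zero => simp
  | add a b _ _ ha hb => rw [add_mul]; exact add_mem ha hb
  | smul r a _ ha => rw [smul_mul_assoc]; exact Submodule.smul_mem _ _ ha

lemma lowDeg_mono {ι : Type*} {d e : ℕ} (h : d ≤ e) : lowDeg ι d ≤ lowDeg ι e :=
  Submodule.span_mono fun _ ⟨T, hT, hg⟩ => ⟨T, hT.trans h, hg⟩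

lemma one_mem_lowDeg {ι : Type*} (d : ℕ) : (1 : (ι → Bool) → ℝ) ∈ lowDeg ι d := by
  have : (1 : (ι → Bool) → ℝ) = chi ∅ := by ext x; simp [chi]
  rw [this]
  exact chi_mem_lowDeg (by simp)

lemma const_mem_lowDeg {ι : Type*} (d : ℕ) (c : ℝ) : (fun _ => c : (ι → Bool) → ℝ) ∈ lowDeg ι d := by
  have := (lowDeg ι d).smul_mem c (one_mem_lowDeg d)
  convert this using 1
  ext x; simp

lemma bit_eq {ι : Type*} (x : ι → Bool) (i : ι) : bit x i = (1 - chi {i} x) / 2 := by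
  rw [chi_eq_prod, Finset.prod_singleton, bit]
  cases x i <;> norm_num [bitSign]

lemma bit_mem_lowDeg {ι : Type*} (i : ι) : (fun x => bit x i : (ι → Bool) → ℝ) ∈ lowDeg ι 1 := by
  have h1 := (lowDeg ι 1).smul_mem (1 / 2 : ℝ)
    ((lowDeg ι 1).sub_mem (one_mem_lowDeg 1) (chi_mem_lowDeg (T := {i}) (by simp)))
  convert h1 using 1
  ext x
  simp only [Pi.smul_apply, Pi.sub_apply, Pi.one_apply, smul_eq_mul, bit_eq]
  ring

lemma eval_mem_lowDeg {ι : Type*} {g : (ι → Bool) → ℝ} (hg : g ∈ lowDeg ι 1) (R : Polynomial ℝ) :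
    (fun x => R.eval (g x)) ∈ lowDeg ι R.natDegree := by
  have hpow : ∀ k : ℕ, g ^ k ∈ lowDeg ι k := by
    intro k
    induction k with
    | zero => simpa using one_mem_lowDeg 0
    | succ k ih => rw [pow_succ]; exact mul_mem_lowDeg ih hg
  have : (fun x => R.eval (g x)) = ∑ k ∈ Finset.range (R.natDegree + 1), R.coeff k • g ^ k := by
    ext x
    simp [Polynomial.eval_eq_sum_range]
  rw [this]
  refine sum_mem fun k hk => Submodule.smul_mem _ _ (lowDeg_mono ?_ (hpow k))
  have := Finset.mem_range.1 hk
  omega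

lemma lowDeg_comp_sumElim_left {α β : Type*} {d : ℕ} {p : (α ⊕ β → Bool) → ℝ}
    (hp : p ∈ lowDeg (α ⊕ β) d) (y : β → Bool) : (fun x => p (Sum.elim x y)) ∈ lowDeg α d := by
  induction hp using Submodule.span_induction with
  | mem f hf =>
    obtain ⟨T, hT, rfl⟩ := hf
    have : (fun x => chi T (Sum.elim x y)) = chi T.toRight y • (chi T.toLeft : (α → Bool) → ℝ) := by
      ext x; simp [chi_sumElim, mul_comm]
    rw [this]
    exact Submodule.smul_mem _ _ (chi_mem_lowDeg (T.card_toLeft_le.trans hT))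
  | zero => exact zero_mem _
  | add a b _ _ ha hb => exact add_mem ha hb
  | smul r a _ ha => exact Submodule.smul_mem _ r ha

lemma lowDeg_comp_sumElim_right {α β : Type*} {d : ℕ} {p : (α ⊕ β → Bool) → ℝ}
    (hp : p ∈ lowDeg (α ⊕ β) d) (x : α → Bool) : (fun y => p (Sum.elim x y)) ∈ lowDeg β d := by
  induction hp using Submodule.span_induction with
  | mem f hf =>
    obtain ⟨T, hT, rfl⟩ := hf
    have : (fun y => chi T (Sum.elim x y)) = chi T.toLeft x • (chi T.toRight : (β → Bool) → ℝ) := by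
      ext x; simp [chi_sumElim]
    rw [this]
    exact Submodule.smul_mem _ _ (chi_mem_lowDeg (T.card_toRight_le.trans hT))
  | zero => exact zero_mem _
  | add a b _ _ ha hb => exact add_mem ha hb
  | smul r a _ ha => exact Submodule.smul_mem _ r ha

/-! ### From threshold density to threshold degree -/

/-- The point of the big cube in which block `i` carries the bit `b i` twice, in the half selected
by `ρ i`, and the bits `a i`, `¬ a i` in the other half. -/
def fill {B ι : Type*} (e : B × Bool × Bool ↪ ι) (c : ι → Bool) (ρ a b : B → Bool) : ι → Bool :=
  Function.extend e (fun q => if q.2.1 = ρ q.1 then b q.1 else xor q.2.2 (a q.1)) c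

/-- `F` restricts to `f` along all fillings of some block structure. -/
def IsLift {B ι : Type*} (F : BoolFun ι) (f : BoolFun B) : Prop :=
  ∃ (e : B × Bool × Bool ↪ ι) (c : ι → Bool), ∀ ρ a b, F (fill e c ρ a b) = f b

/-- Here `m` marks the coordinates of one block used by a character. A half with one marked
coordinate contributes the sign of `b` if selected and averages to zero over `a` otherwise; a half
with zero or two marked ones contributes a constant. So if the total is odd, only selecting the odd
half `r₀` gives a nonzero average. -/
lemma block_average (m : Bool → Bool → Bool) :
    ∃ (odd r₀ : Bool) (k : Bool → ℝ), (∀ ρ b, ∑ a : Bool, ∏ q : Bool × Bool,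
      (if m q.1 q.2 then bitSign (if q.1 = ρ then b else xor q.2 a) else 1) =
        k ρ * if odd then bitSign b else 1) ∧ (odd = true → ∀ ρ, ρ ≠ r₀ → k ρ = 0) := by
  refine ⟨xor (xor (m false false) (m false true)) (xor (m true false) (m true true)),
    xor (m true false) (m true true), fun ρ =>
      ∑ a : Bool, ∏ q : Bool × Bool, (if m q.1 q.2 then bitSign (if q.1 = ρ then false else xor q.2 a) else 1), ?_⟩
  simp only [Fintype.prod_prod_type, Fintype.sum_bool, Fintype.prod_bool]
  generalize m false false = m1
  generalize m false true = m2
  generalize m true false = m3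
  generalize m true true = m4
  constructor
  · intro ρ b
    cases m1 <;> cases m2 <;> cases m3 <;> cases m4 <;> cases ρ <;> cases b <;>
      norm_num [bitSign]
  · intro h ρ
    revert h
    cases m1 <;> cases m2 <;> cases m3 <;> cases m4 <;> cases ρ <;>
      norm_num [bitSign]

/-- The average factors over blocks. `O` collects the blocks that `S` meets in an odd number of
coordinates, and `S` survives only if `ρ` agrees with `r` on all of `O`. -/
lemma chi_fill_average {B ι : Type*} [Fintype B] [DecidableEq B] (e : B × Bool × Bool ↪ ι) (c : ι → Bool)
    (S : Finset ι) :
    ∃ (O : Finset B) (r : B → Bool) (k : (B → Bool) → ℝ),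
      (∀ ρ b, ∑ a : B → Bool, chi S (fill e c ρ a b) = k ρ * chi O b) ∧
      ∀ ρ, (∃ i ∈ O, ρ i ≠ r i) → k ρ = 0 := by
  classical
  choose odd r₀ k hk hk' using fun i : B => block_average (fun r s => decide (e (i, r, s) ∈ S))
  set C : ℝ := ∏ j ∈ S.filter (fun j => j ∉ Set.range e), bitSign (c j)
  have hchi : ∀ ρ a b, chi S (fill e c ρ a b) = C * ∏ i, ∏ q : Bool × Bool,
      (if decide (e (i, q.1, q.2) ∈ S) then
        bitSign (if q.1 = ρ i then b i else xor q.2 (a i)) else 1) := by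
    intro ρ a b
    rw [chi_eq_prod, ← Finset.prod_filter_not_mul_prod_filter S (fun j => j ∈ Set.range e)]
    congr 1
    · refine Finset.prod_congr rfl fun j hj => ?_
      rw [fill, Function.extend_apply' _ _ _ (by simpa using (Finset.mem_filter.1 hj).2)]
    · rw [← Fintype.prod_prod_type' (f := fun i (q : Bool × Bool) =>
        (if decide (e (i, q.1, q.2) ∈ S) then
          bitSign (if q.1 = ρ i then b i else xor q.2 (a i)) else 1))]
      have : S.filter (fun j => j ∈ Set.range e) =
          (Finset.univ.filter fun q => e q ∈ S).map e := by
        ext j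
        simp only [Finset.mem_filter, Set.mem_range, Finset.mem_map, Finset.mem_univ, true_and]
        constructor
        · rintro ⟨h1, q, rfl⟩; exact ⟨q, h1, rfl⟩
        · rintro ⟨q, h1, rfl⟩; exact ⟨h1, q, rfl⟩
      rw [this, Finset.prod_map, Finset.prod_filter]
      refine Finset.prod_congr rfl fun q _ => ?_
      rw [fill, e.injective.extend_apply]
      simp
  refine ⟨Finset.univ.filter fun i => odd i = true, r₀, fun ρ => C * ∏ i, k i (ρ i), ?_, ?_⟩
  · intro ρ b
    simp only [hchi]
    rw [← Finset.mul_sum, ← Fintype.prod_sum (f := fun i (ai : Bool) => ∏ q : Bool × Bool,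
      (if decide (e (i, q.1, q.2) ∈ S) then
        bitSign (if q.1 = ρ i then b i else xor q.2 ai) else 1))]
    simp only [hk]
    rw [Finset.prod_mul_distrib, chi_eq_prod, Finset.prod_filter, mul_assoc]
  · rintro ρ ⟨i, hi, hne⟩
    have := hk' i (by simpa using hi) (ρ i) hne
    show C * ∏ i, k i (ρ i) = 0
    rw [Finset.prod_eq_zero (Finset.mem_univ i) this, mul_zero]

lemma card_agree {B : Type*} [Fintype B] [DecidableEq B] (O : Finset B) (r : B → Bool) :
    (Finset.univ.filter fun ρ : B → Bool => ∀ i ∈ O, ρ i = r i).card =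
      2 ^ (Fintype.card B - O.card) := by
  have : (Finset.univ.filter fun ρ : B → Bool => ∀ i ∈ O, ρ i = r i) =
      Fintype.piFinset fun i => if i ∈ O then {r i} else Finset.univ := by
    ext ρ
    simp only [Finset.mem_filter, Finset.mem_univ, true_and, Fintype.mem_piFinset]
    refine forall_congr' fun i => ?_
    split_ifs with h <;> simp [h]
  rw [this, Fintype.card_piFinset]
  have h2 : ∀ i, (if i ∈ O then ({r i} : Finset Bool) else Finset.univ).card =
      if i ∈ Oᶜ then 2 else 1 := by
    intro i
    by_cases h : i ∈ O <;> simp [h]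
  simp only [h2]
  rw [Finset.prod_ite_mem, Finset.univ_inter, Finset.prod_const, Finset.card_compl]

/-- A function of small threshold density restricts to functions of small threshold degree. -/
theorem exists_lowDeg_signRep_of_dns_lt {B ι : Type*} [Fintype B] [Fintype ι] {F : BoolFun ι}
    {f : BoolFun B} (hF : IsLift F f) {d : ℕ} (hd : dns F < 2 ^ d) :
    ∃ p ∈ lowDeg B d, SignRep f p := by
  classical
  obtain ⟨e, c, hlift⟩ := hF
  obtain ⟨𝒮, hcard, l, hl⟩ := exists_card_eq_dns F
  choose O r k hk hk0 using fun S => chi_fill_average e c S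
  -- Union bound: a character with `d ≤ |O S|` survives for a fraction at most `2 ^ (-d)` of all
  -- `ρ`, and there are fewer than `2 ^ d` characters.
  obtain ⟨ρ, hρ⟩ : ∃ ρ : B → Bool, ∀ S ∈ 𝒮, d ≤ (O S).card → ∃ i ∈ O S, ρ i ≠ r S i := by
    by_contra! hcon
    have hsub : (Finset.univ : Finset (B → Bool)) ⊆ (𝒮.filter fun S => d ≤ (O S).card).biUnion
        fun S => Finset.univ.filter fun ρ : B → Bool => ∀ i ∈ O S, ρ i = r S i := by
      intro ρ _
      obtain ⟨S, hS, hdS, h⟩ := hcon ρ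
      exact Finset.mem_biUnion.2 ⟨S, Finset.mem_filter.2 ⟨hS, hdS⟩, by simpa using h⟩
    have h1 := (Finset.card_le_card hsub).trans Finset.card_biUnion_le
    by_cases hdB : d ≤ Fintype.card B
    · have h2 : ∑ S ∈ 𝒮.filter (fun S => d ≤ (O S).card),
          (Finset.univ.filter fun ρ : B → Bool => ∀ i ∈ O S, ρ i = r S i).card ≤
          𝒮.card * 2 ^ (Fintype.card B - d) := by
        refine (Finset.sum_le_card_nsmul _ _ (2 ^ (Fintype.card B - d)) fun S hS => ?_).trans ?_
        · rw [card_agree]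
          have := (Finset.mem_filter.1 hS).2
          exact Nat.pow_le_pow_right (by norm_num) (by omega)
        · rw [smul_eq_mul]
          exact Nat.mul_le_mul_right _ (Finset.card_filter_le _ _)
      have h3 : 𝒮.card * 2 ^ (Fintype.card B - d) < 2 ^ d * 2 ^ (Fintype.card B - d) :=
        Nat.mul_lt_mul_of_pos_right (hcard ▸ hd) (by positivity)
      rw [← pow_add, Nat.add_sub_cancel' hdB] at h3
      have h4 : (Finset.univ : Finset (B → Bool)).card = 2 ^ Fintype.card B := by simp
      omega
    · have h2 : 𝒮.filter (fun S => d ≤ (O S).card) = ∅ := by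
        refine Finset.filter_eq_empty_iff.2 fun S _ h => ?_
        have := (O S).card_le_univ
        omega
      rw [h2] at h1
      simp at h1
  -- Summing over `a` keeps the sign, because the value of `F` on a filling depends on `b` alone.
  refine ⟨fun b => ∑ a, ∑ S ∈ 𝒮, l S * chi S (fill e c ρ a b), ?_, ?_⟩
  · have : (fun b => ∑ a, ∑ S ∈ 𝒮, l S * chi S (fill e c ρ a b)) =
        ∑ S ∈ 𝒮, (l S * k S ρ) • (chi (O S) : (B → Bool) → ℝ) := by
      ext b
      rw [Finset.sum_comm]
      simp only [Finset.sum_apply, Pi.smul_apply, smul_eq_mul]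
      refine Finset.sum_congr rfl fun S _ => ?_
      rw [← Finset.mul_sum, hk, mul_assoc]
    rw [this]
    refine sum_mem fun S hS => ?_
    by_cases h : d ≤ (O S).card
    · rw [hk0 S ρ (hρ S hS h)]
      simp
    · exact Submodule.smul_mem _ _ (chi_mem_lowDeg (by omega))
  · refine signRep_of (fun b hb => ?_) (fun b hb => ?_)
    · exact Finset.sum_pos (fun a _ => hl.pos_of_eq_one (by rw [hlift, hb])) Finset.univ_nonempty
    · exact Finset.sum_neg (fun a _ => hl.neg_of_eq_neg_one (by rw [hlift, hb]))
        Finset.univ_nonempty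

lemma IsLift.conj {B C ι κ : Type*} {F : BoolFun ι} {f : BoolFun B} {G : BoolFun κ} {g : BoolFun C}
    (hF : IsLift F f) (hG : IsLift G g) : IsLift (conj F G) (conj f g) := by
  obtain ⟨e, c, h⟩ := hF
  obtain ⟨e', c', h'⟩ := hG
  let E : (B ⊕ C) × Bool × Bool → ι ⊕ κ := fun q =>
    q.1.elim (fun i => Sum.inl (e (i, q.2))) (fun j => Sum.inr (e' (j, q.2)))
  have hE : Function.Injective E := by
    rintro ⟨i | i, q⟩ ⟨j | j, q'⟩ hij
    · have := e.injective (Sum.inl.inj hij)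
      simp_all
    · simp [E] at hij
    · simp [E] at hij
    · have := e'.injective (Sum.inr.inj hij)
      simp_all
  refine ⟨⟨E, hE⟩, Sum.elim c c', fun ρ a b => ?_⟩
  have h1 : (fun i => fill ⟨E, hE⟩ (Sum.elim c c') ρ a b (Sum.inl i)) =
      fill e c (fun i => ρ (Sum.inl i)) (fun i => a (Sum.inl i)) (fun i => b (Sum.inl i)) := by
    ext i
    by_cases hi : ∃ q, e q = i
    · obtain ⟨q, rfl⟩ := hi
      have : Sum.inl (e q) = E (Sum.inl q.1, q.2) := rfl
      rw [this]
      simp only [fill]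
      rw [e.injective.extend_apply]
      exact hE.extend_apply _ _ _
    · simp only [fill]
      rw [Function.extend_apply' _ _ _ hi, Function.extend_apply']
      · rfl
      · rintro ⟨⟨q1 | q1, q2⟩, hq⟩
        · exact hi ⟨_, Sum.inl.inj hq⟩
        · simp [E] at hq
  have h2 : (fun j => fill ⟨E, hE⟩ (Sum.elim c c') ρ a b (Sum.inr j)) =
      fill e' c' (fun i => ρ (Sum.inr i)) (fun i => a (Sum.inr i)) (fun i => b (Sum.inr i)) := by
    ext i
    by_cases hi : ∃ q, e' q = i
    · obtain ⟨q, rfl⟩ := hi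
      have : Sum.inr (e' q) = E (Sum.inr q.1, q.2) := rfl
      rw [this]
      simp only [fill]
      rw [e'.injective.extend_apply]
      exact hE.extend_apply _ _ _
    · simp only [fill]
      rw [Function.extend_apply' _ _ _ hi, Function.extend_apply']
      · rfl
      · rintro ⟨⟨q1 | q1, q2⟩, hq⟩
        · simp [E] at hq
        · exact hi ⟨_, Sum.inr.inj hq⟩
  simp only [ThresholdDensity.conj, h1, h2, h, h']

/-! ### Random weights: second moments of the residue classes -/

/-- The subset sum `∑ wᵢ xᵢ` modulo `M`. -/
def modSum {ι : Type*} [Fintype ι] {M : ℕ} (w : ι → ZMod M) (x : ι → Bool) : ZMod M :=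
  ∑ i, if x i then w i else 0

/-- The centred indicator of the event that the subset sum of `x` equals `t`. -/
def hit {ι : Type*} [Fintype ι] {M : ℕ} (w : ι → ZMod M) (t : ZMod M) (x : ι → Bool) : ℝ :=
  (if modSum w x = t then 1 else 0) - 1 / M

lemma hit_sq_le_one {ι : Type*} [Fintype ι] {M : ℕ} [NeZero M] (w : ι → ZMod M) (t : ZMod M) (x : ι → Bool) : hit w t x ^ 2 ≤ 1 := by
  have hM : (1 : ℝ) ≤ M := by exact_mod_cast NeZero.one_le
  have hM' : (1 / M : ℝ) ≤ 1 := by rw [div_le_one (by linarith)]; exact hM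
  have hp : 0 ≤ (1 / M : ℝ) := by positivity
  unfold hit
  split_ifs <;> nlinarith

section SecondMoment

variable {ι : Type*} [Fintype ι] [DecidableEq ι] {M : ℕ}

lemma modSum_add_single (w : ι → ZMod M) (i : ι) (c : ZMod M) (x : ι → Bool) :
    modSum (w + Pi.single i c) x = modSum w x + if x i then c else 0 := by
  have : ∀ j, (if x j then (w + Pi.single i c : ι → ZMod M) j else 0) =
      (if x j then w j else 0) + if j = i then (if x i then c else 0) else 0 := by
    intro j
    by_cases hj : j = i
    · subst hj
      by_cases hx : x j <;> simp [hx]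
    · simp [hj]
  simp only [modSum, this, Finset.sum_add_distrib]
  simp

lemma hit_shift (w : ι → ZMod M) (t : ZMod M) {x : ι → Bool} {i : ι} (hi : x i = false)
    (c : ZMod M) : hit (w + Pi.single i c) t x = hit w t x := by
  simp [hit, modSum_add_single, hi]

variable [NeZero M]

lemma sum_hit_shift (w : ι → ZMod M) (t : ZMod M) {x : ι → Bool} {i : ι} (hi : x i = true) :
    ∑ c : ZMod M, hit (w + Pi.single i c) t x = 0 := by
  simp only [hit, modSum_add_single, hi, if_true, Finset.sum_sub_distrib]
  have : ∀ c, (modSum w x + c = t) ↔ (c = t - modSum w x) := by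
    intro c
    rw [eq_sub_iff_add_eq, add_comm]
  simp only [this]
  have hM : (M : ℝ) ≠ 0 := by exact_mod_cast NeZero.ne M
  simp [ZMod.card, hM]

/-- Averaging over all weights is the same as first averaging over shifts of one weight. -/
lemma sum_eq_zero_of_shift (F : (ι → ZMod M) → ℝ) (i : ι)
    (h : ∀ w : ι → ZMod M, ∑ c : ZMod M, F (w + Pi.single i c) = 0) : ∑ w, F w = 0 := by
  have h1 : ∀ c : ZMod M, ∑ w : ι → ZMod M, F (w + Pi.single i c) = ∑ w, F w := fun c =>
    Equiv.sum_comp (Equiv.addRight (Pi.single i c : ι → ZMod M)) F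
  have h2 : ∑ c : ZMod M, ∑ w : ι → ZMod M, F (w + Pi.single i c) = 0 := by
    rw [Finset.sum_comm]
    exact Finset.sum_eq_zero fun w _ => h w
  simp only [h1, Finset.sum_const, Finset.card_univ, ZMod.card, nsmul_eq_mul] at h2
  have hM : (M : ℝ) ≠ 0 := by exact_mod_cast NeZero.ne M
  exact (mul_eq_zero.1 h2).resolve_left hM

/-- At a coordinate where `x` and `y` differ, shifting that weight moves only one of the two subset
sums, and its centred indicator averages to zero. -/
lemma sum_hit_mul_hit (t : ZMod M) {x y : ι → Bool} (h : x ≠ y) :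
    ∑ w, hit w t x * hit w t y = 0 := by
  obtain ⟨i, hi⟩ := Function.ne_iff.1 h
  refine sum_eq_zero_of_shift _ i fun w => ?_
  cases hx : x i
  · have hy : y i = true := by cases hy : y i <;> simp_all
    simp only [hit_shift w t hx, ← Finset.mul_sum, sum_hit_shift w t hy, mul_zero]
  · have hy : y i = false := by cases hy : y i <;> simp_all
    simp only [hit_shift w t hy, ← Finset.sum_mul, sum_hit_shift w t hx, zero_mul]

lemma sum_hit_sq_le (t : ZMod M) {x : ι → Bool} (h : ∃ i, x i = true) :
    ∑ w, hit w t x ^ 2 ≤ Fintype.card (ι → ZMod M) * (1 / M : ℝ) := by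
  obtain ⟨i, hi⟩ := h
  have h0 : ∑ w, hit w t x = 0 := sum_eq_zero_of_shift _ i fun w => sum_hit_shift w t hi
  have hM : (1 : ℝ) ≤ M := by exact_mod_cast NeZero.one_le
  have hM' : (1 / M : ℝ) ≤ 1 := by rw [div_le_one (by linarith)]; exact hM
  have hp : 0 ≤ (1 / M : ℝ) := by positivity
  -- `hit` takes two values, so its square is an affine function of it; the linear part has mean
  -- zero.
  have : ∀ w, hit w t x ^ 2 ≤ hit w t x * (1 - 2 / M) + 1 / M := by
    intro w
    have e : (2 / M : ℝ) = 2 * (1 / M) := by ring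
    unfold hit
    rw [e]
    split_ifs <;> nlinarith
  refine (Finset.sum_le_sum fun w _ => this w).trans ?_
  rw [Finset.sum_add_distrib, ← Finset.sum_mul, h0]
  simp

lemma sum_bias_sq_le (t : ZMod M) (S : Finset ι) :
    ∑ w : ι → ZMod M, (∑ x, chi S x * hit w t x) ^ 2 ≤
      Fintype.card (ι → ZMod M) * (2 ^ Fintype.card ι / M + 1 : ℝ) := by
  have h1 : ∑ w : ι → ZMod M, (∑ x, chi S x * hit w t x) ^ 2 =
      ∑ x, ∑ y, chi S x * chi S y * ∑ w : ι → ZMod M, hit w t x * hit w t y := by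
    simp only [sq, Finset.sum_mul_sum]
    simp only [Finset.mul_sum]
    rw [Finset.sum_comm]
    refine Finset.sum_congr rfl fun x _ => ?_
    rw [Finset.sum_comm]
    refine Finset.sum_congr rfl fun y _ => Finset.sum_congr rfl fun w _ => by ring
  have h2 : ∀ x, ∑ y, chi S x * chi S y * ∑ w : ι → ZMod M, hit w t x * hit w t y =
      ∑ w : ι → ZMod M, hit w t x ^ 2 := by
    intro x
    rw [Finset.sum_eq_single x]
    · rw [chi_mul_self, one_mul]
      simp only [sq]
    · intro y _ hy
      rw [sum_hit_mul_hit t hy.symm, mul_zero]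
    · simp
  rw [h1]
  simp only [h2]
  set C : ℝ := (Fintype.card (ι → ZMod M) : ℝ)
  have hC : 0 ≤ C := by positivity
  have hp : 0 ≤ (1 / M : ℝ) := by positivity
  -- The all-zero point has subset sum 0 for every `w`, so it is not random and gets the trivial
  -- bound.
  have h3 : ∀ x : ι → Bool, ∑ w : ι → ZMod M, hit w t x ^ 2 ≤
      C * (1 / M : ℝ) + if x = fun _ => false then C else 0 := by
    intro x
    split_ifs with hx
    · have : ∑ w : ι → ZMod M, hit w t x ^ 2 ≤ ∑ w : ι → ZMod M, (1 : ℝ) :=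
        Finset.sum_le_sum fun w _ => hit_sq_le_one w t x
      rw [Finset.sum_const, nsmul_eq_mul, mul_one, Finset.card_univ] at this
      nlinarith
    · obtain ⟨i, hi⟩ := Function.ne_iff.1 hx
      have := sum_hit_sq_le t (x := x) ⟨i, by simpa using hi⟩
      linarith
  refine (Finset.sum_le_sum fun x _ => h3 x).trans (le_of_eq ?_)
  rw [Finset.sum_add_distrib]
  simp
  ring

/-- Some choice of weights makes every residue class almost unbiased. -/
lemma exists_weights_small_bias (𝒟 : Finset (Finset ι)) :
    ∃ w : ι → ZMod M, ∀ t, ∀ S ∈ 𝒟, (∑ x, chi S x * hit w t x) ^ 2 ≤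
      𝒟.card * (2 ^ Fintype.card ι + M : ℝ) := by
  have hM : (0 : ℝ) < M := by exact_mod_cast Nat.pos_of_ne_zero (NeZero.ne M)
  have hsum : ∑ w : ι → ZMod M, ∑ t : ZMod M, ∑ S ∈ 𝒟, (∑ x, chi S x * hit w t x) ^ 2 ≤
      ∑ w : ι → ZMod M, (𝒟.card * (2 ^ Fintype.card ι + M) : ℝ) := by
    rw [Finset.sum_comm]
    have : ∀ t : ZMod M, ∑ w : ι → ZMod M, ∑ S ∈ 𝒟, (∑ x, chi S x * hit w t x) ^ 2 ≤
        𝒟.card * (Fintype.card (ι → ZMod M) * (2 ^ Fintype.card ι / M + 1 : ℝ)) := by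
      intro t
      rw [Finset.sum_comm, ← nsmul_eq_mul]
      exact Finset.sum_le_card_nsmul _ _ _ fun S _ => sum_bias_sq_le t S
    refine (Finset.sum_le_sum fun t _ => this t).trans (le_of_eq ?_)
    simp only [Finset.sum_const, Finset.card_univ, ZMod.card, nsmul_eq_mul]
    field_simp
  obtain ⟨w, _, hw⟩ := Finset.exists_le_of_sum_le Finset.univ_nonempty hsum
  refine ⟨w, fun t S hS => le_trans ?_ hw⟩
  refine le_trans ?_ (Finset.single_le_sum (f := fun t => ∑ S ∈ 𝒟, (∑ x, chi S x * hit w t x) ^ 2)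
    (fun t _ => Finset.sum_nonneg fun S _ => sq_nonneg _) (Finset.mem_univ t))
  exact Finset.single_le_sum (f := fun S => (∑ x, chi S x * hit w t x) ^ 2)
    (fun S _ => sq_nonneg _) hS

end SecondMoment

/-! ### Exactly unbiased measures on residue classes -/

/-- A set of points on which all characters of degree at most `2 d` have small bias carries a
probability measure on which those of degree between `1` and `d` are exactly unbiased. -/
lemma exists_unbiased_measure {ι : Type*} [Fintype ι] [DecidableEq ι] (Y : Finset (ι → Bool))
    {d : ℕ} {μ δ D : ℝ} (hD : 1 ≤ D)
    (hcard : ((Finset.univ.filter fun S : Finset ι => S.card ≤ d).card : ℝ) ≤ D) (hδ : 2 * δ * D < μ)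
    (hbias : ∀ S : Finset ι, S.card ≤ 2 * d → |∑ x ∈ Y, chi S x - if S = ∅ then μ else 0| ≤ δ) :
    ∃ ν : (ι → Bool) → ℝ, (∀ x, 0 ≤ ν x) ∧ ∑ x, ν x = 1 ∧ (∀ x, x ∉ Y → ν x = 0) ∧
      ∀ S : Finset ι, S.Nonempty → S.card ≤ d → ∑ x, ν x * chi S x = 0 := by
  have hδ0 : 0 ≤ δ := (abs_nonneg _).trans (hbias ∅ (by simp))
  have hY : Y.Nonempty := by
    by_contra h
    rw [Finset.not_nonempty_iff_eq_empty] at h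
    have := hbias ∅ (by simp)
    simp only [h, Finset.sum_empty, if_true, zero_sub, abs_neg] at this
    have := (le_abs_self μ).trans this
    nlinarith
  let 𝒟 : Finset (Finset ι) := Finset.univ.filter fun S => S.Nonempty ∧ S.card ≤ d
  have h𝒟D : (𝒟.card : ℝ) ≤ D := by
    refine le_trans ?_ hcard
    have : 𝒟 ⊆ Finset.univ.filter fun S : Finset ι => S.card ≤ d := fun S hS => by
      simp only [𝒟, Finset.mem_filter] at hS ⊢
      exact ⟨hS.1, hS.2.2⟩
    exact_mod_cast Finset.card_le_card this
  let Φ : (Y → ℝ) →ₗ[ℝ] (𝒟 → ℝ) :=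
    { toFun := fun ν S => ∑ x : Y, ν x * chi S.1 x.1
      map_add' := by intro a b; ext S; simp [add_mul, Finset.sum_add_distrib]
      map_smul' := by intro r a; ext S; simp [Finset.mul_sum, mul_assoc] }
  have hΦ : Continuous Φ := Φ.continuous_of_finiteDimensional
  by_cases h0 : (0 : 𝒟 → ℝ) ∈ Φ '' stdSimplex ℝ Y
  · obtain ⟨ν, ⟨hν0, hν1⟩, hν⟩ := h0
    have conv : ∀ g : (ι → Bool) → ℝ, ∑ x, (if h : x ∈ Y then ν ⟨x, h⟩ else 0) * g x =
        ∑ x : Y, ν x * g x := by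
      intro g
      rw [← Finset.sum_subset (Finset.subset_univ Y), ← Finset.sum_coe_sort Y]
      · refine Finset.sum_congr rfl fun x _ => ?_
        simp
      · intro x _ hx
        simp [hx]
    refine ⟨fun x => if h : x ∈ Y then ν ⟨x, h⟩ else 0, fun x => ?_, ?_, fun x hx => ?_,
      fun S hS hSd => ?_⟩
    · dsimp only
      split_ifs with h
      · exact hν0 _
      · exact le_rfl
    · have := conv fun _ => 1
      simp only [mul_one] at this
      rw [this, hν1]
    · simp [hx]
    · rw [conv]
      exact congrFun hν ⟨S, by simp [𝒟, hS, hSd]⟩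
  exfalso
  -- If no such measure exists, separation yields a polynomial `p` of degree at most `d` with no
  -- constant term, positive on `Y`. Small bias makes `∑ p` small and `∑ p ^ 2` large on `Y`,
  -- contradicting `p ^ 2 ≤ α p`, where `α` is the sum of the absolute coefficients.
  obtain ⟨f, u, hu, hf⟩ := geometric_hahn_banach_point_closed
    ((convex_stdSimplex ℝ Y).linear_image Φ) ((isCompact_stdSimplex ℝ Y).image hΦ).isClosed h0
  rw [map_zero] at hu
  set a : 𝒟 → ℝ := fun S => f (Pi.single S 1)
  have hfa : ∀ v, f v = ∑ S, a S * v S := by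
    intro v
    have := LinearMap.pi_apply_eq_sum_univ (f : (𝒟 → ℝ) →ₗ[ℝ] ℝ) v
    simp only [ContinuousLinearMap.coe_coe] at this
    rw [this]
    refine Finset.sum_congr rfl fun S _ => ?_
    rw [smul_eq_mul, mul_comm]
    congr 2
    ext T
    simp [Pi.single_apply, eq_comm]
  set p : (ι → Bool) → ℝ := fun x => ∑ S : 𝒟, a S * chi S.1 x
  have hp : ∀ x ∈ Y, 0 < p x := by
    intro x hx
    have h := hf _ ⟨_, single_mem_stdSimplex ℝ (⟨x, hx⟩ : Y), rfl⟩
    rw [hfa] at h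
    have e : ∀ S : 𝒟, Φ (Pi.single ⟨x, hx⟩ 1) S = chi S.1 x := by
      intro S
      show ∑ y : Y, (Pi.single ⟨x, hx⟩ 1 : Y → ℝ) y * chi S.1 y.1 = _
      rw [Finset.sum_eq_single ⟨x, hx⟩]
      · simp
      · intro y _ hy; simp [hy]
      · simp
    simp only [e] at h
    exact hu.trans h
  set α := ∑ S : 𝒟, |a S|
  have hα : 0 ≤ α := Finset.sum_nonneg fun _ _ => abs_nonneg _
  have hpα : ∀ x, p x ≤ α := fun x => Finset.sum_le_sum fun S _ => by
    refine (le_abs_self _).trans ?_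
    rw [abs_mul, abs_chi, mul_one]
  have hsum1 : ∑ x ∈ Y, p x ≤ α * δ := by
    simp only [p]
    rw [Finset.sum_comm, Finset.sum_mul]
    refine Finset.sum_le_sum fun S _ => ?_
    rw [← Finset.mul_sum]
    have hS : S.1.Nonempty ∧ S.1.card ≤ d := (Finset.mem_filter.1 S.2).2
    have := hbias S.1 (by omega)
    rw [if_neg hS.1.ne_empty, sub_zero] at this
    refine (le_abs_self _).trans ?_
    rw [abs_mul]
    exact mul_le_mul_of_nonneg_left this (abs_nonneg _)
  have hsum2 : μ * ∑ S : 𝒟, a S ^ 2 - δ * α ^ 2 ≤ ∑ x ∈ Y, p x ^ 2 := by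
    have e1 : ∑ x ∈ Y, p x ^ 2 = ∑ S : 𝒟, ∑ T : 𝒟, a S * a T * ∑ x ∈ Y, chi (symmDiff S.1 T.1) x := by
      simp only [p, sq, Finset.sum_mul_sum]
      simp only [Finset.mul_sum]
      rw [Finset.sum_comm]
      refine Finset.sum_congr rfl fun S _ => ?_
      rw [Finset.sum_comm]
      refine Finset.sum_congr rfl fun T _ => Finset.sum_congr rfl fun x _ => ?_
      rw [← chi_mul_chi]; ring
    have e2 : μ * ∑ S : 𝒟, a S ^ 2 = ∑ S : 𝒟, ∑ T : 𝒟, a S * a T * if S = T then μ else 0 := by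
      rw [Finset.mul_sum]
      refine Finset.sum_congr rfl fun S _ => ?_
      simp only [mul_ite, mul_zero, Finset.sum_ite_eq, Finset.mem_univ, if_true]
      ring
    have e3 : δ * α ^ 2 = ∑ S : 𝒟, ∑ T : 𝒟, |a S| * |a T| * δ := by
      simp only [α, sq, Finset.sum_mul_sum]
      simp only [Finset.mul_sum]
      refine Finset.sum_congr rfl fun S _ => Finset.sum_congr rfl fun T _ => by ring
    rw [e1, e2, e3, ← Finset.sum_sub_distrib]
    refine Finset.sum_le_sum fun S _ => ?_
    rw [← Finset.sum_sub_distrib]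
    refine Finset.sum_le_sum fun T _ => ?_
    have hS : S.1.Nonempty ∧ S.1.card ≤ d := (Finset.mem_filter.1 S.2).2
    have hT : T.1.Nonempty ∧ T.1.card ≤ d := (Finset.mem_filter.1 T.2).2
    have hc : (symmDiff S.1 T.1).card ≤ 2 * d := by
      calc (symmDiff S.1 T.1).card ≤ (S.1 ∪ T.1).card := Finset.card_le_card (by
            rw [← Finset.sup_eq_union]; exact symmDiff_le_sup)
        _ ≤ S.1.card + T.1.card := Finset.card_union_le _ _
        _ ≤ 2 * d := by omega
    have hb := hbias _ hc
    have heq : (symmDiff S.1 T.1 = ∅) ↔ S = T := by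
      rw [← Finset.bot_eq_empty, symmDiff_eq_bot, Subtype.ext_iff]
    simp only [heq] at hb
    have := (neg_abs_le (a S * a T * (∑ x ∈ Y, chi (symmDiff S.1 T.1) x - if S = T then μ else 0)))
    rw [abs_mul, abs_mul] at this
    have h5 := mul_le_mul_of_nonneg_left hb (mul_nonneg (abs_nonneg (a S)) (abs_nonneg (a T)))
    rw [mul_sub] at this
    linarith
  have hsum3 : ∑ x ∈ Y, p x ^ 2 ≤ α * ∑ x ∈ Y, p x := by
    rw [Finset.mul_sum]
    refine Finset.sum_le_sum fun x hx => ?_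
    rw [sq]
    exact mul_le_mul_of_nonneg_right (hpα x) (hp x hx).le
  have hcs : α ^ 2 ≤ D * ∑ S : 𝒟, a S ^ 2 := by
    have := sq_sum_le_card_mul_sum_sq (s := Finset.univ) (f := fun S : 𝒟 => |a S|)
    simp only [sq_abs, Finset.card_univ, Fintype.card_coe] at this
    exact this.trans (mul_le_mul_of_nonneg_right h𝒟D (Finset.sum_nonneg fun _ _ => sq_nonneg _))
  have hpos : 0 < ∑ S : 𝒟, a S ^ 2 := by
    refine (Finset.sum_nonneg fun _ _ => sq_nonneg _).lt_of_ne fun h => ?_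
    have hz := (Finset.sum_eq_zero_iff_of_nonneg fun (S : 𝒟) _ => sq_nonneg (a S)).1 h.symm
    obtain ⟨x, hx⟩ := hY
    have : p x = 0 := Finset.sum_eq_zero fun S hS => by
      rw [pow_eq_zero_iff two_ne_zero |>.1 (hz S hS), zero_mul]
    exact (hp x hx).ne' this
  have h6 : α * ∑ x ∈ Y, p x ≤ α * (α * δ) := mul_le_mul_of_nonneg_left hsum1 hα
  have h7 : μ * ∑ S : 𝒟, a S ^ 2 ≤ 2 * δ * (D * ∑ S : 𝒟, a S ^ 2) := by
    have := mul_le_mul_of_nonneg_left hcs hδ0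
    nlinarith
  nlinarith

/-- A Chernoff-type count: weight each set by `(1 / 16) ^ |S|`. The total weight is `(17 / 16) ^ (64
q) ≤ 2 ^ (6 q)`, and each counted set weighs at least `2 ^ (-8 q)`. -/
lemma card_small_sets_le {ι : Type*} [Fintype ι] {q : ℕ} (hι : Fintype.card ι = 64 * q) :
    ((Finset.univ.filter fun S : Finset ι => S.card ≤ 2 * q).card : ℝ) ≤ 2 ^ (14 * q) := by
  have h1 := Finset.sum_pow_mul_eq_add_pow (1 / 16 : ℝ) 1 (Finset.univ : Finset ι)
  simp only [one_pow, mul_one, Finset.powerset_univ, Finset.card_univ, hι] at h1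
  have h2 : ((Finset.univ.filter fun S : Finset ι => S.card ≤ 2 * q).card : ℝ) * (1 / 16) ^ (2 * q) ≤
      (1 / 16 + 1) ^ (64 * q) := by
    rw [← h1, ← nsmul_eq_mul]
    refine le_trans (Finset.card_nsmul_le_sum _ _ _ fun S hS => ?_)
      (Finset.sum_le_sum_of_subset_of_nonneg (Finset.filter_subset _ _) fun _ _ _ => by positivity)
    exact pow_le_pow_of_le_one (by norm_num) (by norm_num) (Finset.mem_filter.1 hS).2
  have h3 : ((1 / 16 + 1 : ℝ)) ^ (64 * q) ≤ 2 ^ (6 * q) := by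
    rw [pow_mul, pow_mul]
    exact pow_le_pow_left₀ (by positivity) (by norm_num) q
  have h4 : (2 : ℝ) ^ (6 * q) = 2 ^ (14 * q) * (1 / 16) ^ (2 * q) := by
    rw [pow_mul, pow_mul, pow_mul, ← mul_pow]
    norm_num
  rw [h4] at h3
  exact le_of_mul_le_mul_right (h2.trans h3) (by positivity)

/-- There are weights such that every residue class of the subset sum carries a probability measure
indistinguishable from the uniform one by characters of degree at most `q`. -/
theorem exists_fooling_weights {ι : Type*} [Fintype ι] [DecidableEq ι] {q : ℕ} (hq : 1 ≤ q)
    (hι : Fintype.card ι = 64 * q) :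
    ∃ w : ι → ZMod (2 ^ q), ∀ t : ZMod (2 ^ q), ∃ ν : (ι → Bool) → ℝ, (∀ x, 0 ≤ ν x) ∧
      ∑ x, ν x = 1 ∧ (∀ x, modSum w x ≠ t → ν x = 0) ∧
      ∀ S : Finset ι, S.Nonempty → S.card ≤ q → ∑ x, ν x * chi S x = 0 := by
  classical
  have : NeZero (2 ^ q) := ⟨by positivity⟩
  set 𝒟 := Finset.univ.filter fun S : Finset ι => S.card ≤ 2 * q
  have hD := card_small_sets_le hι
  obtain ⟨w, hw⟩ := exists_weights_small_bias (ι := ι) (M := 2 ^ q) 𝒟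
  refine ⟨w, fun t => ?_⟩
  -- `μ = 2 ^ (64 q) / 2 ^ q` is the expected class size. The squared bias is at most `2 ^ (78 q +
  -- 1) ≤ 2 ^ (88 q)`, whence `δ`; then `2 δ D = 2 ^ (58 q + 1) < μ`.
  obtain ⟨ν, h1, h2, h3, h4⟩ := exists_unbiased_measure (Finset.univ.filter fun x => modSum w x = t)
    (d := q) (μ := 2 ^ (63 * q)) (δ := 2 ^ (44 * q)) (D := 2 ^ (14 * q))
    (one_le_pow₀ (by norm_num)) (le_trans (by
      exact_mod_cast Finset.card_le_card fun S hS => by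
        simp only [Finset.mem_filter] at hS ⊢
        exact ⟨hS.1, by omega⟩) hD) (by
      rw [mul_assoc, ← pow_add, ← pow_succ']
      exact pow_lt_pow_right₀ (by norm_num) (by omega)) fun S hS => by
      have hb := hw t S (by simp [𝒟, hS])
      have e : ∑ x, chi S x * hit w t x =
          ∑ x ∈ Finset.univ.filter (fun x => modSum w x = t), chi S x -
            if S = ∅ then 2 ^ (63 * q) else 0 := by
        simp only [hit, mul_sub, Finset.sum_sub_distrib, mul_ite, mul_one, mul_zero,
          Finset.sum_filter]
        congr 1
        rw [← Finset.sum_mul]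
        split_ifs with hSe
        · subst hSe
          simp only [chi_empty, Finset.sum_const, Finset.card_univ, Fintype.card_fun,
            Fintype.card_bool, hι, nsmul_eq_mul, mul_one]
          push_cast
          rw [mul_one_div, div_eq_iff (by positivity), ← pow_add]
          congr 1; ring
        · have : ∑ x : ι → Bool, chi S x = 0 := by
            have := Finset.prod_univ_sum (fun _ : ι => (Finset.univ : Finset Bool))
              (fun i b => if i ∈ S then bitSign b else (1 : ℝ))
            rw [Fintype.piFinset_univ] at this
            have h2 : ∀ x : ι → Bool, chi S x = ∏ i, if i ∈ S then bitSign (x i) else 1 := by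
              intro x
              rw [chi_eq_prod, Finset.prod_ite_mem, Finset.univ_inter]
            simp only [h2, ← this]
            obtain ⟨i, hi⟩ := Finset.nonempty_iff_ne_empty.2 hSe
            exact Finset.prod_eq_zero (Finset.mem_univ i) (by simp [hi, bitSign])
          rw [this, zero_mul]
      rw [← e]
      refine abs_le_of_sq_le_sq ?_ (by positivity)
      refine hb.trans ?_
      rw [hι]
      push_cast
      have h5 : (2 : ℝ) ^ q ≤ 2 ^ (64 * q) := pow_le_pow_right₀ (by norm_num) (by omega)
      calc (𝒟.card : ℝ) * (2 ^ (64 * q) + 2 ^ q) ≤ 2 ^ (14 * q) * (2 * 2 ^ (64 * q)) := by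
            gcongr
            linarith
        _ = 2 ^ (14 * q + (64 * q + 1)) := by rw [pow_add, pow_succ]; ring
        _ ≤ 2 ^ (44 * q * 2) := pow_le_pow_right₀ (by norm_num) (by omega)
        _ = (2 ^ (44 * q)) ^ 2 := pow_mul _ _ _
  exact ⟨ν, h1, h2, fun x hx => h3 x (by simp [hx]), h4⟩

/-! ### Symmetrization over the levels of the cube -/

/-- The number of ones of `b`. -/
def ones {B : Type*} [Fintype B] (b : B → Bool) : ℕ := ∑ i, (b i).toNat

lemma ones_eq_card {B : Type*} [Fintype B] (b : B → Bool) :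
    ones b = (Finset.univ.filter fun i => b i = true).card := by
  rw [ones, Finset.card_filter]
  refine Finset.sum_congr rfl fun i _ => ?_
  cases b i <;> simp

/-- The uniform distribution on the points with exactly `j` ones. -/
def levelUniform {B : Type*} [Fintype B] (j : ℕ) (b : B → Bool) : ℝ :=
  if ones b = j then 1 / ((Fintype.card B).choose j : ℝ) else 0

lemma levelUniform_nonneg {B : Type*} [Fintype B] (j : ℕ) (b : B → Bool) : 0 ≤ levelUniform j b := by
  unfold levelUniform
  split_ifs <;> positivity

section Symmetrization

variable {B : Type*} [Fintype B] [DecidableEq B]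

lemma card_level_superset (U : Finset B) {j : ℕ} (hj : U.card ≤ j) :
    (Finset.univ.filter fun b : B → Bool => ones b = j ∧ ∀ i ∈ U, b i = true).card =
      (Fintype.card B - U.card).choose (j - U.card) := by
  rw [← Finset.card_compl, ← Finset.card_powersetCard]
  refine Finset.card_nbij' (fun b => (Finset.univ.filter fun i => b i = true) \ U)
    (fun Z i => decide (i ∈ Z ∪ U)) ?_ ?_ ?_ ?_
  · intro b hb
    obtain ⟨h1, h2⟩ := (Finset.mem_filter.1 hb).2
    rw [Finset.mem_coe, Finset.mem_powersetCard]
    constructor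
    · intro i hi
      exact Finset.mem_compl.2 (Finset.mem_sdiff.1 hi).2
    · rw [Finset.card_sdiff_of_subset, ← ones_eq_card, h1]
      intro i hi
      simpa using h2 i hi
  · intro Z hZ
    rw [Finset.mem_coe, Finset.mem_powersetCard] at hZ
    have hd : Disjoint Z U := by
      rw [Finset.disjoint_left]
      intro i hi
      exact Finset.mem_compl.1 (hZ.1 hi)
    simp only [Finset.coe_filter, Finset.mem_univ, true_and, Set.mem_ofPred_eq, decide_eq_true_eq]
    refine ⟨?_, fun i hi => Finset.mem_union_right _ hi⟩
    rw [ones_eq_card]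
    simp only [decide_eq_true_eq, Finset.filter_mem_eq_inter, Finset.univ_inter]
    rw [Finset.card_union_of_disjoint hd, hZ.2]
    omega
  · intro b hb
    obtain ⟨h1, h2⟩ := (Finset.mem_filter.1 hb).2
    ext i
    by_cases hi : i ∈ U
    · simp [hi, h2 i hi]
    · simp [hi]
  · intro Z hZ
    rw [Finset.mem_coe, Finset.mem_powersetCard] at hZ
    ext i
    by_cases hi : i ∈ U
    · simp only [Finset.mem_sdiff, hi, not_true_eq_false, and_false, false_iff]
      intro h
      exact Finset.mem_compl.1 (hZ.1 h) hi
    · simp [hi]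

lemma sum_levelUniform_monomial (U : Finset B) {j : ℕ} (hj : j ≤ Fintype.card B) :
    ∑ b : B → Bool, levelUniform j b * (if ∀ i ∈ U, b i = true then 1 else 0) =
      (j.choose U.card : ℝ) / (Fintype.card B).choose U.card := by
  have h1 : ∑ b : B → Bool, levelUniform j b * (if ∀ i ∈ U, b i = true then 1 else 0) =
      (Finset.univ.filter fun b : B → Bool => ones b = j ∧ ∀ i ∈ U, b i = true).card *
        (1 / ((Fintype.card B).choose j : ℝ)) := by
    rw [← nsmul_eq_mul, ← Finset.sum_const, Finset.sum_filter]
    refine Finset.sum_congr rfl fun b _ => ?_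
    unfold levelUniform
    split_ifs <;> simp_all
  rw [h1]
  have p1 : ((Fintype.card B).choose j : ℝ) ≠ 0 := by
    exact_mod_cast (Nat.choose_pos hj).ne'
  have p2 : ((Fintype.card B).choose U.card : ℝ) ≠ 0 := by
    exact_mod_cast (Nat.choose_pos U.card_le_univ).ne'
  by_cases hU : U.card ≤ j
  · rw [card_level_superset U hU, mul_one_div, div_eq_div_iff p1 p2]
    have := Nat.choose_mul (n := Fintype.card B) (k := j) (s := U.card) hU
    have h2 : ((Fintype.card B).choose j : ℝ) * j.choose U.card =
        (Fintype.card B).choose U.card * (Fintype.card B - U.card).choose (j - U.card) := by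
      exact_mod_cast this
    linarith
  · rw [Nat.choose_eq_zero_of_lt (not_le.1 hU)]
    have : (Finset.univ.filter fun b : B → Bool => ones b = j ∧ ∀ i ∈ U, b i = true) = ∅ := by
      refine Finset.filter_eq_empty_iff.2 fun b _ h => hU ?_
      rw [← h.1, ones_eq_card]
      exact Finset.card_le_card fun i hi => by simpa using h.2 i hi
    simp [this]

lemma sum_levelUniform {j : ℕ} (hj : j ≤ Fintype.card B) :
    ∑ b : B → Bool, levelUniform j b = 1 := by
  simpa using sum_levelUniform_monomial (∅ : Finset B) hj

/-- The average of a character of degree `k` over a level of the cube is a polynomial of degree at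
most `k` in the level. -/
lemma exists_poly_sum_levelUniform_chi (T : Finset B) :
    ∃ R : ℝ[X], R.natDegree ≤ T.card ∧ ∀ j : ℕ, j ≤ Fintype.card B →
      ∑ b : B → Bool, levelUniform j b * chi T b = R.eval (j : ℝ) := by
  -- Expand `chi T` as `∏ (1 - 2 bᵢ)`. The monomial of `U` averages to a ratio of binomial
  -- coefficients, a falling factorial in `j` up to a constant.
  refine ⟨∑ U ∈ T.powerset, C ((-2 : ℝ) ^ U.card / ((Fintype.card B).choose U.card * U.card.factorial)) *
    descPochhammer ℝ U.card, ?_, fun j hj => ?_⟩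
  · refine natDegree_sum_le_of_forall_le _ _ fun U hU => ?_
    refine (natDegree_C_mul_le _ _).trans ?_
    rw [descPochhammer_natDegree]
    exact Finset.card_le_card (Finset.mem_powerset.1 hU)
  · have hchi : ∀ b : B → Bool, chi T b =
        ∑ U ∈ T.powerset, (-2) ^ U.card * (if ∀ i ∈ U, b i = true then (1 : ℝ) else 0) := by
      intro b
      have : chi T b = ∏ i ∈ T, (1 + -2 * (if b i = true then (1 : ℝ) else 0)) := by
        rw [chi_eq_prod]
        refine Finset.prod_congr rfl fun i _ => ?_
        cases b i <;> norm_num [bitSign]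
      rw [this, Finset.prod_one_add]
      refine Finset.sum_congr rfl fun U _ => ?_
      rw [Finset.prod_mul_distrib, Finset.prod_const]
      congr 1
      by_cases h : ∀ i ∈ U, b i = true
      · rw [if_pos h]
        exact Finset.prod_eq_one fun i hi => by simp [h i hi]
      · rw [if_neg h]
        push Not at h
        obtain ⟨i, hi, hb⟩ := h
        exact Finset.prod_eq_zero hi (by simp [hb])
    simp only [hchi, Finset.mul_sum]
    rw [Finset.sum_comm, eval_finsetSum]
    refine Finset.sum_congr rfl fun U _ => ?_
    simp only [mul_left_comm (levelUniform j _), ← Finset.mul_sum]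
    rw [sum_levelUniform_monomial U hj, eval_mul, eval_C, descPochhammer_eval_eq_descFactorial,
      Nat.descFactorial_eq_factorial_mul_choose]
    have p2 : ((Fintype.card B).choose U.card : ℝ) ≠ 0 := by
      exact_mod_cast (Nat.choose_pos U.card_le_univ).ne'
    have p3 : (U.card.factorial : ℝ) ≠ 0 := by exact_mod_cast U.card.factorial_ne_zero
    push_cast
    field_simp

end Symmetrization

/-! ### Distributions along which low-degree averages are polynomial -/

/-- A sequence of probability distributions indexed by the integers `t ∈ A`, each supported on
points where `f` is the sign of `t`, along which low-degree functions average to polynomials of the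
same degree in `t`. -/
def Resolves {B : Type*} [Fintype B] [DecidableEq B] (f : BoolFun B) (D : ℕ) (A : Set ℤ) : Prop :=
  ∃ ν : ℤ → (B → Bool) → ℝ,
    (∀ t ∈ A, (∀ b, 0 ≤ ν t b) ∧ ∑ b, ν t b = 1 ∧
      ∀ b, ν t b ≠ 0 → f b = if t < 0 then -1 else 1) ∧
    ∀ T : Finset B, T.card ≤ D → ∃ Q : ℝ[X], Q.natDegree ≤ T.card ∧
      ∀ t ∈ A, ∑ b, ν t b * chi T b = Q.eval (t : ℝ)

lemma exists_poly_average {B : Type*} [Fintype B] [DecidableEq B] {ν : ℤ → (B → Bool) → ℝ} {D : ℕ}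
    {A : Set ℤ} (h : ∀ T : Finset B, T.card ≤ D → ∃ Q : ℝ[X], Q.natDegree ≤ T.card ∧
      ∀ t ∈ A, ∑ b, ν t b * chi T b = Q.eval (t : ℝ)) {d : ℕ} (hd : d ≤ D)
    {p : (B → Bool) → ℝ} (hp : p ∈ lowDeg B d) :
    ∃ Q : ℝ[X], Q.natDegree ≤ d ∧ ∀ t ∈ A, ∑ b, ν t b * p b = Q.eval (t : ℝ) := by
  induction hp using Submodule.span_induction with
  | mem f hf =>
    obtain ⟨T, hT, rfl⟩ := hf
    obtain ⟨Q, h1, h2⟩ := h T (hT.trans hd)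
    exact ⟨Q, h1.trans hT, h2⟩
  | zero => exact ⟨0, by simp, by simp⟩
  | add a b _ _ ha hb =>
    obtain ⟨Q, h1, h2⟩ := ha
    obtain ⟨Q', h1', h2'⟩ := hb
    refine ⟨Q + Q', (natDegree_add_le _ _).trans (max_le h1 h1'), fun t ht => ?_⟩
    rw [eval_add, ← h2 t ht, ← h2' t ht, ← Finset.sum_add_distrib]
    simp [mul_add]
  | smul r a _ ha =>
    obtain ⟨Q, h1, h2⟩ := ha
    refine ⟨C r * Q, (natDegree_C_mul_le _ _).trans h1, fun t ht => ?_⟩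
    rw [eval_mul, eval_C, ← h2 t ht, Finset.mul_sum]
    simp [mul_left_comm]

/-- The function that is true exactly above level `J` of the cube. -/
def aboveLevel (B : Type*) [Fintype B] (J : ℕ) : BoolFun B := fun b => if J < ones b then -1 else 1

/-- Take the uniform distribution on level `J - t`; the set of `t` is exactly where this level
exists. -/
lemma resolves_aboveLevel (B : Type*) [Fintype B] [DecidableEq B] (J D : ℕ) :
    Resolves (aboveLevel B J) D {t : ℤ | t ≤ J ∧ (J : ℤ) - t ≤ Fintype.card B} := by
  refine ⟨fun t => levelUniform (J - t : ℤ).toNat, fun t ht => ⟨fun b => levelUniform_nonneg _ b,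
    ?_, fun b hb => ?_⟩, fun T _ => ?_⟩
  · rw [← sum_levelUniform (B := B) (j := (J - t : ℤ).toNat) (by have := ht.1; have := ht.2; omega)]
  · have h1 : ones b = (J - t : ℤ).toNat := by
      by_contra h
      exact hb (by simp [levelUniform, h])
    have := ht.1
    have : J < ones b ↔ t < 0 := by omega
    simp [aboveLevel, this]
  · obtain ⟨R, hR, h⟩ := exists_poly_sum_levelUniform_chi T
    refine ⟨R.comp (C (J : ℝ) - X), ?_, fun t ht => ?_⟩
    · refine natDegree_comp_le.trans ?_
      have : (C (J : ℝ) - X : ℝ[X]).natDegree ≤ 1 :=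
        (natDegree_sub_le _ _).trans (by simp)
      nlinarith
    · have h1 := h (J - t : ℤ).toNat (by have := ht.1; have := ht.2; omega)
      have h2 : (((J - t : ℤ).toNat : ℕ) : ℝ) = J - t := by
        have := ht.1
        have e : (((J - t : ℤ).toNat : ℕ) : ℤ) = J - t := Int.toNat_of_nonneg (by omega)
        exact_mod_cast congrArg (Int.cast : ℤ → ℝ) e
      rw [eval_comp, eval_sub, eval_C, eval_X, ← h2, ← h1]

lemma sum_sumElim {α β : Type*} [Fintype α] [Fintype β] [DecidableEq α] [DecidableEq β]
    (g : (α ⊕ β → Bool) → ℝ) : ∑ b, g b = ∑ x : α → Bool, ∑ y : β → Bool, g (Sum.elim x y) := by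
  rw [← Fintype.sum_prod_type']
  refine Fintype.sum_equiv (Equiv.sumArrowEquivProdArrow α β Bool) _ _ fun b => ?_
  congr 1
  ext i
  rcases i with i | i <;> rfl

/-! ### The carry halfspace -/

/-- The integer linear form `∑ Wᵢ bᵢ`. -/
def intForm {B : Type*} [Fintype B] (W : B → ℤ) (b : B → Bool) : ℤ := ∑ i, W i * ((b i).toNat : ℤ)

/-- The halfspace that is false exactly where `k < ∑ Wᵢ bᵢ`. -/
def intHalfspace {B : Type*} [Fintype B] (W : B → ℤ) (k : ℤ) : BoolFun B :=
  fun b => if k < intForm W b then 1 else -1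

lemma cast_intForm {B : Type*} [Fintype B] (W : B → ℤ) (b : B → Bool) :
    (intForm W b : ℝ) = ∑ i, (W i : ℝ) * bit b i := by
  simp [intForm, bit]

lemma isHalfspace_intHalfspace {B : Type*} [Fintype B] (W : B → ℤ) (k : ℤ) :
    IsHalfspace (intHalfspace W k) := by
  refine ⟨fun i => W i, k + 1 / 2, signRep_of (fun b hb => ?_) fun b hb => ?_⟩
  · rw [← cast_intForm]
    have h : k < intForm W b := by
      by_contra h
      simp [intHalfspace, h] at hb
    have : ((k + 1 : ℤ) : ℝ) ≤ intForm W b := by exact_mod_cast h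
    push_cast at this
    linarith
  · rw [← cast_intForm]
    have h : ¬ k < intForm W b := by
      intro h
      simp [intHalfspace, h] at hb
    have : (intForm W b : ℝ) ≤ k := by exact_mod_cast not_lt.1 h
    linarith

/-- The weights of a linear form equal to a subset sum minus `M` times a carry. -/
def carryWeights {X Y : Type*} {M : ℕ} (w : X → ZMod M) : X ⊕ Y → ℤ :=
  Sum.elim (fun i => ((w i).val : ℤ)) (fun _ => -(M : ℤ))

lemma intForm_carryWeights {X Y : Type*} [Fintype X] [Fintype Y] {M : ℕ} (w : X → ZMod M)
    (b : X ⊕ Y → Bool) : intForm (carryWeights w) b =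
      intForm (fun i => ((w i).val : ℤ)) (fun i => b (Sum.inl i)) -
        M * ones (fun j => b (Sum.inr j)) := by
  simp only [intForm, carryWeights, Fintype.sum_sum_type, Sum.elim_inl, Sum.elim_inr, ones]
  push_cast
  rw [Finset.mul_sum]
  simp only [neg_mul, Finset.sum_neg_distrib]
  rfl

lemma intForm_val_cast {X : Type*} [Fintype X] {M : ℕ} [NeZero M] (w : X → ZMod M) (x : X → Bool) :
    ((intForm (fun i => ((w i).val : ℤ)) x : ℤ) : ZMod M) = modSum w x := by
  simp only [intForm, modSum]
  push_cast
  refine Finset.sum_congr rfl fun i _ => ?_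
  cases x i <;> simp

lemma intForm_val_bounds {X : Type*} [Fintype X] {M : ℕ} [NeZero M] (w : X → ZMod M) (x : X → Bool) :
    0 ≤ intForm (fun i => ((w i).val : ℤ)) x ∧
      intForm (fun i => ((w i).val : ℤ)) x ≤ Fintype.card X * ((M : ℤ) - 1) := by
  constructor
  · exact Finset.sum_nonneg fun i _ => by positivity
  · have : intForm (fun i => ((w i).val : ℤ)) x ≤ ∑ _i : X, ((M : ℤ) - 1) := by
      refine Finset.sum_le_sum fun i _ => ?_
      have h1 : ((w i).val : ℤ) < M := by exact_mod_cast ZMod.val_lt (w i)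
      have h2 : (0 : ℤ) ≤ (w i).val := by positivity
      cases x i
      · simp only [Bool.toNat_false, Nat.cast_zero, mul_zero]; omega
      · simp only [Bool.toNat_true, Nat.cast_one, mul_one]; omega
    rwa [Finset.sum_const, Finset.card_univ, nsmul_eq_mul] at this

/-- Draw `x` from the fooling measure on the residue class of `t`, then `y` uniformly from level `(S
x - t) / M`, so the linear form equals `t`. Averaging over `y` leaves a function of `x` of degree at
most `q`, whose mean is the same under every fooling measure; computing it under the fixed measure
`μ 0` exhibits a polynomial in `t`. The value `t = 0` is excluded because the halfspace is true
there. -/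
theorem resolves_carry {X Y : Type*} [Fintype X] [Fintype Y] [DecidableEq X] [DecidableEq Y] {q : ℕ} (hXY : Fintype.card X =
    Fintype.card Y) (w : X → ZMod (2 ^ q))
    (hw : ∀ t : ZMod (2 ^ q), ∃ ν : (X → Bool) → ℝ, (∀ x, 0 ≤ ν x) ∧
      ∑ x, ν x = 1 ∧ (∀ x, modSum w x ≠ t → ν x = 0) ∧
      ∀ S : Finset X, S.Nonempty → S.card ≤ q →
        ∑ x, ν x * chi S x = 0) :
    Resolves (intHalfspace (carryWeights w : X ⊕ Y → ℤ) 0) q {t : ℤ | t ≠ 0 ∧ |t| < 2 ^ q} := by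
  have : NeZero (2 ^ q) := ⟨by positivity⟩
  choose μ h0 h1 h2 h3 using hw
  set S : (X → Bool) → ℤ := intForm fun i => ((w i).val : ℤ)
  set M : ℤ := 2 ^ q
  have hM : 0 < M := by positivity
  have hMR : (M : ℝ) ≠ 0 := by exact_mod_cast hM.ne'
  set j : ℤ → (X → Bool) → ℕ := fun t x => ((S x - t) / M).toNat
  have hj : ∀ t : ℤ, |t| < 2 ^ q → ∀ x, μ t x ≠ 0 → M * (j t x : ℤ) = S x - t ∧
      j t x ≤ Fintype.card Y := by
    intro t ht x hx
    have hmod : modSum w x = (t : ZMod (2 ^ q)) := by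
      by_contra h
      exact hx (h2 _ x h)
    have hdvd : M ∣ S x - t := by
      have : (((S x - t : ℤ)) : ZMod (2 ^ q)) = 0 := by
        rw [Int.cast_sub, intForm_val_cast, hmod, sub_self]
      have := (ZMod.intCast_zmod_eq_zero_iff_dvd _ _).1 this
      simpa [M] using this
    obtain ⟨k, hk⟩ := hdvd
    have hb := intForm_val_bounds w x
    have htt := abs_lt.1 ht
    have hb2 : S x ≤ Fintype.card X * (M - 1) := by
      have := hb.2
      push_cast at this
      exact this
    -- The bounds `0 ≤ S x ≤ |X| (M - 1)` and `|t| < M` confine the carry to `0, …, |X|`, which is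
    -- why `|Y| = |X|` suffices.
    have hk0 : 0 ≤ k := by
      have h : M * (-1) < M * k := by
        have := hb.1
        change 0 ≤ S x at this
        have := htt.2
        change t < M at this
        linarith
      have := lt_of_mul_lt_mul_left h hM.le
      omega
    have hk1 : k ≤ Fintype.card Y := by
      have h : M * k < M * (Fintype.card X + 1) := by
        have := htt.1
        change -M < t at this
        have : (0 : ℤ) ≤ Fintype.card X := by positivity
        nlinarith
      have := lt_of_mul_lt_mul_left h hM.le
      omega
    have e : (j t x : ℤ) = k := by
      simp only [j]
      rw [hk, Int.mul_ediv_cancel_left _ hM.ne', Int.toNat_of_nonneg hk0]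
    exact ⟨by rw [e, hk], by omega⟩
  refine ⟨fun t b => μ t (fun i => b (Sum.inl i)) *
    levelUniform (j t fun i => b (Sum.inl i)) (fun i => b (Sum.inr i)), fun t ht =>
    ⟨fun b => mul_nonneg (h0 _ _) (levelUniform_nonneg _ _), ?_, fun b hb => ?_⟩, fun T hT => ?_⟩
  · rw [sum_sumElim]
    simp only [Sum.elim_inl, Sum.elim_inr]
    rw [← h1 t]
    refine Finset.sum_congr rfl fun x _ => ?_
    rw [← Finset.mul_sum]
    by_cases hx : μ t x = 0
    · rw [hx, zero_mul]
    · rw [sum_levelUniform (hj t ht.2 x hx).2, mul_one]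
  · have hx := left_ne_zero_of_mul hb
    have hy := right_ne_zero_of_mul hb
    have hones : ones (fun i => b (Sum.inr i)) = j t fun i => b (Sum.inl i) := by
      by_contra h
      exact hy (by simp [levelUniform, h])
    have hform : intForm (carryWeights w : X ⊕ Y → ℤ) b = t := by
      rw [intForm_carryWeights, hones]
      have := (hj t ht.2 _ hx).1
      simp only [M] at this
      push_cast
      linarith
    have ht0 := ht.1
    simp only [intHalfspace, hform]
    rcases lt_or_gt_of_ne ht0 with h | h
    · rw [if_pos h, if_neg (by omega)]
    · rw [if_pos h, if_neg (by omega)]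
  · obtain ⟨R, hR, hRe⟩ := exists_poly_sum_levelUniform_chi T.toRight
    have hcard := T.card_toLeft_add_card_toRight
    refine ⟨∑ x, C (μ 0 x * chi T.toLeft x) *
      R.comp (C ((S x : ℝ) / M) - C (1 / (M : ℝ)) * Polynomial.X), ?_, fun t ht => ?_⟩
    · refine natDegree_sum_le_of_forall_le _ _ fun x _ => (natDegree_C_mul_le _ _).trans ?_
      refine natDegree_comp_le.trans ?_
      have : (C ((S x : ℝ) / M) - C (1 / (M : ℝ)) * Polynomial.X : ℝ[X]).natDegree ≤ 1 := by
        refine (natDegree_sub_le _ _).trans (max_le (by simp) ?_)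
        exact (natDegree_C_mul_le _ _).trans (by simp)
      nlinarith
    · have hsame : ∀ g ∈ lowDeg X q, ∑ x, μ t x * g x = ∑ x, μ 0 x * g x := by
        intro g hg
        induction hg using Submodule.span_induction with
        | mem f hf =>
          obtain ⟨U, hU, rfl⟩ := hf
          rcases U.eq_empty_or_nonempty with rfl | hne
          · simp only [chi_empty, mul_one]
            rw [h1, h1]
          · rw [h3 _ U hne hU, h3 _ U hne hU]
        | zero => simp
        | add a b _ _ ha hb => simp only [Pi.add_apply, mul_add, Finset.sum_add_distrib, ha, hb]
        | smul r a _ ha =>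
          simp only [Pi.smul_apply, smul_eq_mul, mul_left_comm, ← Finset.mul_sum, ha]
      have hlow : (fun x => chi T.toLeft x * R.eval (((S x : ℝ) - t) / M)) ∈ lowDeg X q := by
        have hlin : (fun x => ((S x : ℝ) - t) / M) ∈ lowDeg X 1 := by
          have e : (fun x => ((S x : ℝ) - t) / M) = (1 / (M : ℝ)) •
              (∑ i, ((w i).val : ℝ) • (fun x : X → Bool => bit x i) - fun _ => (t : ℝ)) := by
            ext x
            simp only [S, cast_intForm, Pi.smul_apply, Pi.sub_apply, Finset.sum_apply, smul_eq_mul]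
            push_cast
            ring
          rw [e]
          refine Submodule.smul_mem _ _ (Submodule.sub_mem _ (sum_mem fun i _ =>
            Submodule.smul_mem _ _ (bit_mem_lowDeg i)) (const_mem_lowDeg 1 _))
        exact lowDeg_mono (by omega) (mul_mem_lowDeg (chi_mem_lowDeg le_rfl) (eval_mem_lowDeg hlin R))
      have hs := hsame _ hlow
      rw [sum_sumElim]
      simp only [Sum.elim_inl, Sum.elim_inr, chi_sumElim]
      have hleft : ∀ x, ∑ y : Y → Bool, μ t x * levelUniform (j t x) y *
          (chi T.toLeft x * chi T.toRight y) =
          μ t x * (chi T.toLeft x * R.eval (((S x : ℝ) - t) / M)) := by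
        intro x
        by_cases hx : μ t x = 0
        · simp [hx]
        · obtain ⟨a1, a2⟩ := hj t ht.2 x hx
          have : ((S x : ℝ) - t) / M = j t x := by
            rw [div_eq_iff hMR, mul_comm]
            exact_mod_cast a1.symm
          rw [this, ← hRe _ a2, Finset.mul_sum, Finset.mul_sum]
          refine Finset.sum_congr rfl fun y _ => by ring
      simp only [hleft]
      rw [hs, eval_finsetSum]
      refine Finset.sum_congr rfl fun x _ => ?_
      rw [eval_mul, eval_C, eval_comp, eval_sub, eval_C, eval_mul, eval_C, eval_X, mul_assoc]
      congr 3
      ring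

/-! ### Linear threshold functions as lifts -/

lemma sum_fill {B ι : Type*} [Fintype B] [Fintype ι] {R : Type*} [CommRing R]
    (e : B × Bool × Bool ↪ ι) (c : ι → Bool) (ρ a b : B → Bool) (W : B → R) (φ : ι → R)
    (hφ : ∀ j ∉ Set.range e, φ j * ((c j).toNat : R) = 0) (hφ' : ∀ q, φ (e q) = W q.1) :
    ∑ j, φ j * ((fill e c ρ a b j).toNat : R) = ∑ i, W i * (2 * ((b i).toNat : R) + 1) := by
  rw [← Fintype.sum_of_injective e e.injective
    (fun q => W q.1 * ((if q.2.1 = ρ q.1 then b q.1 else xor q.2.2 (a q.1)).toNat : R))]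
  -- In a block the selected half contributes `2 b` and the other half a bit plus its complement,
  -- that is 1, whatever `ρ` and `a` are.
  · simp only [Fintype.sum_prod_type, Fintype.sum_bool]
    refine Finset.sum_congr rfl fun i _ => ?_
    cases ρ i <;> cases a i <;> cases b i <;> simp <;> ring
  · intro j hj
    rw [fill, Function.extend_apply' _ _ _ (by simpa using hj)]
    exact hφ j hj
  · intro q
    rw [fill, e.injective.extend_apply, hφ']

lemma isLift_intHalfspace {B ι : Type*} [Fintype B] [Fintype ι] (e : B × Bool × Bool ↪ ι)
    (W : B → ℤ) :
    IsLift (intHalfspace (Function.extend e (fun q => W q.1) 0) (∑ i, W i)) (intHalfspace W 0) := by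
  refine ⟨e, fun _ => false, fun ρ a b => ?_⟩
  have h : intForm (Function.extend e (fun q => W q.1) 0) (fill e (fun _ => false) ρ a b) =
      2 * intForm W b + ∑ i, W i := by
    rw [intForm, sum_fill e _ ρ a b W _ (fun j hj => by simp)
      (fun q => e.injective.extend_apply _ _ _), intForm, Finset.mul_sum, ← Finset.sum_add_distrib]
    refine Finset.sum_congr rfl fun i _ => by ring
  have h2 : (∑ i, W i < 2 * intForm W b + ∑ i, W i) ↔ 0 < intForm W b := by omega
  simp only [intHalfspace, h, h2]

lemma isLift_maj (n : ℕ) :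
    IsLift (maj n) (aboveLevel (Fin (n / 4)) ((n - 2 * (n / 4)) / 4)) := by
  obtain ⟨e⟩ : Nonempty (Fin (n / 4) × Bool × Bool ↪ Fin n) :=
    Function.Embedding.nonempty_of_card_le (by simp; omega)
  refine ⟨e, fun _ => false, fun ρ a b => ?_⟩
  have h : ∑ j, bit (fill e (fun _ => false) ρ a b) j = 2 * (ones b : ℝ) + (n / 4 : ℕ) := by
    have := sum_fill (R := ℝ) e (fun _ => false) ρ a b (fun _ => 1) (fun _ => 1)
      (fun j hj => by simp) (fun q => rfl)
    simp only [one_mul, Finset.sum_add_distrib, ← Finset.mul_sum] at this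
    simp only [bit, this, ones]
    push_cast
    simp
  have h2 : ((n : ℝ) / 2 < 2 * (ones b : ℝ) + (n / 4 : ℕ)) ↔ (n - 2 * (n / 4)) / 4 < ones b := by
    rw [div_lt_iff₀ (by norm_num)]
    have : ((n : ℝ) < (2 * (ones b : ℝ) + (n / 4 : ℕ)) * 2) ↔ n < (2 * ones b + n / 4) * 2 := by
      exact_mod_cast Iff.rfl
    rw [this]
    omega
  simp only [maj, aboveLevel, h, h2]

/-! ### Lower bounds for conjunctions -/

lemma sum_mul_pos_of_pos_on_support {α : Type*} [Fintype α] {ν g : α → ℝ} (h0 : ∀ x, 0 ≤ ν x)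
    (h1 : ∑ x, ν x = 1) (hg : ∀ x, ν x ≠ 0 → 0 < g x) : 0 < ∑ x, ν x * g x := by
  have hnn : ∀ x, 0 ≤ ν x * g x := fun x => by
    by_cases h : ν x = 0
    · simp [h]
    · exact mul_nonneg (h0 x) (hg x h).le
  obtain ⟨x, hx⟩ : ∃ x, ν x ≠ 0 := by
    by_contra! h
    simp [h] at h1
  exact Finset.sum_pos' (fun x _ => hnn x)
    ⟨x, Finset.mem_univ x, mul_pos ((h0 x).lt_of_ne (Ne.symm hx)) (hg x hx)⟩

/-- Averaging `p` over the product of the two resolving distributions gives a function of two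
integers with the sign pattern of the conjunction and degree at most `d` in each variable;
`card_le_of_sign_pattern` then applies. -/
theorem card_le_of_signRep_conj {B C : Type*} [Fintype B] [Fintype C] [DecidableEq B]
    [DecidableEq C] {f : BoolFun B} {g : BoolFun C} {D d V : ℕ} {A A' : Set ℤ} (hf : Resolves f D A)
    (hg : Resolves g D A') (hd : d ≤ D) {p : (B ⊕ C → Bool) → ℝ} (hp : p ∈ lowDeg (B ⊕ C) d)
    (hs : SignRep (conj f g) p) {I J : Type*} (s : Finset I) (a : I → ℤ) (u : Finset J) (τ : J → ℤ)
    (w : J → ℝ) (hw : ∀ j ∈ u, 0 ≤ w j) (hW : 0 < ∑ j ∈ u, w j)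
    (ha : ∀ i ∈ s, 0 < a i ∧ a i ∈ A ∧ -a i ∈ A) (hτ : ∀ j ∈ u, 0 < τ j ∧ τ j ∈ A' ∧ -τ j ∈ A')
    {E E' : ℝ} (hV : 1 ≤ V) (hE0 : 0 ≤ E) (hE0' : 0 ≤ E')
    (hE : ∀ r : ℝ, 0 ≤ r → ∑ i ∈ s, 1 * logDist 1 ((a i : ℝ) + r) (a i - r) ≤ E)
    (hE' : ∀ r : ℝ, 0 ≤ r → ∑ j ∈ u, w j * logDist V ((τ j : ℝ) + r) (τ j - r) ≤ E')
    (hVE : 4 * (d * E') ≤ V * ∑ j ∈ u, w j) :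
    (s.card : ℝ) ≤ 16 * (2 * V + 1) * (d * E) := by
  obtain ⟨ν, hν, hνQ⟩ := hf
  obtain ⟨ν', hν', hνQ'⟩ := hg
  set P : ℤ → ℤ → ℝ := fun t t' => ∑ x, ν t x * ∑ y, ν' t' y * p (Sum.elim x y)
  have hposP : ∀ t ∈ A, ∀ t' ∈ A', ¬ (t < 0 ∧ t' < 0) → 0 < P t t' := by
    intro t ht t' ht' hn
    refine sum_mul_pos_of_pos_on_support (hν t ht).1 (hν t ht).2.1 fun x hx =>
      sum_mul_pos_of_pos_on_support (hν' t' ht').1 (hν' t' ht').2.1 fun y hy =>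
      hs.pos_of_eq_one ?_
    have h1 := (hν t ht).2.2 x hx
    have h2 := (hν' t' ht').2.2 y hy
    simp only [conj, Sum.elim_inl, Sum.elim_inr, h1, h2]
    by_cases a1 : t < 0 <;> by_cases a2 : t' < 0 <;> simp_all
  have hnegP : ∀ t ∈ A, ∀ t' ∈ A', t < 0 → t' < 0 → P t t' < 0 := by
    intro t ht t' ht' ht0 ht0'
    have : 0 < ∑ x, ν t x * ∑ y, ν' t' y * (-p (Sum.elim x y)) := by
      refine sum_mul_pos_of_pos_on_support (hν t ht).1 (hν t ht).2.1 fun x hx =>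
        sum_mul_pos_of_pos_on_support (hν' t' ht').1 (hν' t' ht').2.1 fun y hy =>
        neg_pos.2 (hs.neg_of_eq_neg_one ?_)
      have h1 := (hν t ht).2.2 x hx
      have h2 := (hν' t' ht').2.2 y hy
      simp [conj, h1, h2, ht0, ht0']
    simp only [mul_neg, Finset.sum_neg_distrib] at this
    linarith
  have hnat : ∀ (q : ℝ[X]), q.natDegree ≤ d → ∀ {F : ℝ}, 0 ≤ F → (q.natDegree : ℝ) * F ≤ d * F :=
    fun q hq F hF => mul_le_mul_of_nonneg_right (by exact_mod_cast hq) hF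
  refine card_le_of_sign_pattern (d := d) (Et := d * E') s a u τ w hw hW P hV ?_ ?_ ?_ ?_ ?_ ?_ ?_ ?_ hVE
  · intro i hi j hj
    have := (ha i hi).1
    have := (hτ j hj).1
    exact hnegP _ (ha i hi).2.2 _ (hτ j hj).2.2 (by omega) (by omega)
  · intro i hi j hj
    have := (ha i hi).1
    exact hposP _ (ha i hi).2.1 _ (hτ j hj).2.1 (by omega)
  · intro i hi j hj
    have := (ha i hi).1
    exact hposP _ (ha i hi).2.1 _ (hτ j hj).2.2 (by omega)
  · intro i hi j hj
    have := (hτ j hj).1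
    exact hposP _ (ha i hi).2.2 _ (hτ j hj).2.1 (by omega)
  · intro j _ σ _
    have hmem : (fun x => ∑ y, ν' σ y * p (Sum.elim x y)) ∈ lowDeg B d := by
      have : (fun x => ∑ y, ν' σ y * p (Sum.elim x y)) =
          ∑ y, ν' σ y • (fun x => p (Sum.elim x y)) := by
        ext x; simp
      rw [this]
      exact sum_mem fun y _ => Submodule.smul_mem _ _ (lowDeg_comp_sumElim_left hp y)
    obtain ⟨Q, hQ, hQe⟩ := exists_poly_average hνQ hd hmem
    refine ⟨Q, hQ, fun i hi => ⟨hQe _ (ha i hi).2.1, ?_⟩⟩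
    have := hQe _ (ha i hi).2.2
    rw [Int.cast_neg] at this
    exact this
  · intro i _
    have hmem : (fun y => ∑ x, ν (a i) x * p (Sum.elim x y)) ∈ lowDeg C d := by
      have : (fun y => ∑ x, ν (a i) x * p (Sum.elim x y)) =
          ∑ x, ν (a i) x • (fun y => p (Sum.elim x y)) := by
        ext x; simp
      rw [this]
      exact sum_mem fun y _ => Submodule.smul_mem _ _ (lowDeg_comp_sumElim_right hp y)
    obtain ⟨Q, hQ, hQe⟩ := exists_poly_average hνQ' hd hmem
    have hswap : ∀ t', P (a i) t' = ∑ y, ν' t' y * ∑ x, ν (a i) x * p (Sum.elim x y) := by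
      intro t'
      simp only [P, Finset.mul_sum]
      rw [Finset.sum_comm]
      refine Finset.sum_congr rfl fun y _ => Finset.sum_congr rfl fun x _ => by ring
    refine ⟨Q, hQ, fun j hj => ⟨(hswap _).trans (hQe _ (hτ j hj).2.1), ?_⟩⟩
    have := hQe _ (hτ j hj).2.2
    rw [Int.cast_neg] at this
    exact (hswap _).trans this
  · intro q hq hqd
    have := sum_logDist_eval_le s (fun i => (a i : ℝ)) (fun _ => 1)
      (fun i hi => by exact_mod_cast (ha i hi).1) (fun _ _ => zero_le_one) zero_le_one hE q hq
    simp only [one_mul] at this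
    exact this.trans (hnat q hqd hE0)
  · intro q hq hqd
    have := sum_logDist_eval_le u (fun j => (τ j : ℝ)) w
      (fun j hj => by exact_mod_cast (hτ j hj).1) hw (Nat.cast_nonneg V) hE' q hq
    exact this.trans (hnat q hqd hE0')

lemma pow_two_mem_grid {q i : ℕ} (hi : i ∈ Finset.range q) :
    (0 : ℤ) < 2 ^ i ∧ (2 : ℤ) ^ i ∈ {t : ℤ | t ≠ 0 ∧ |t| < 2 ^ q} ∧
      -(2 : ℤ) ^ i ∈ {t : ℤ | t ≠ 0 ∧ |t| < 2 ^ q} := by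
  have h : (0 : ℤ) < 2 ^ i := by positivity
  have h2 : (2 : ℤ) ^ i < 2 ^ q := pow_lt_pow_right₀ (by norm_num) (Finset.mem_range.1 hi)
  refine ⟨h, ⟨h.ne', by rwa [abs_of_pos h]⟩, neg_ne_zero.2 h.ne', ?_⟩
  rwa [abs_neg, abs_of_pos h]

lemma sum_logDist_geometric_int (q : ℕ) (r : ℝ) (hr : 0 ≤ r) :
    ∑ i ∈ Finset.range q, 1 * logDist 1 (((2 ^ i : ℤ) : ℝ) + r) (((2 ^ i : ℤ) : ℝ) - r) ≤ 24 := by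
  have := sum_logDist_geometric q hr
  push_cast
  exact this

/-- Both grids consist of the `q` powers of 2 below `2 ^ q`. With `V = 1` the bound reads `q ≤ 16 *
3 * 24 * d = 1152 * d`. -/
theorem pow_le_dns_conj_self {ι : Type*} [Fintype ι] {B : Type*} [Fintype B] [DecidableEq B]
    {h : BoolFun ι} {f : BoolFun B} {q d : ℕ} (hl : IsLift h f)
    (hr : Resolves f q {t : ℤ | t ≠ 0 ∧ |t| < 2 ^ q}) (hdq : 1152 * d < q) :
    2 ^ d ≤ dns (conj h h) := by
  by_contra! hlt
  obtain ⟨p, hp, hs⟩ := exists_lowDeg_signRep_of_dns_lt (hl.conj hl) hlt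
  have hq : (1152 * d : ℝ) < q := by exact_mod_cast hdq
  have hd0 : (0 : ℝ) ≤ d := by positivity
  have := card_le_of_signRep_conj hr hr (by omega) hp hs (Finset.range q) (fun i => 2 ^ i)
    (Finset.range q) (fun i => 2 ^ i) (fun _ => 1) (fun _ _ => zero_le_one) (by simp; omega)
    (fun i hi => pow_two_mem_grid hi) (fun i hi => pow_two_mem_grid hi) (V := 1) (E := 24) (E' := 24) le_rfl
    (by norm_num) (by norm_num) (sum_logDist_geometric_int q)
    (by simpa using sum_logDist_geometric_int q)
    (by simp; linarith)
  simp at this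
  linarith

lemma log_le_sum_inv {T R : ℕ} (hT : 1 ≤ T) (hTR : T ≤ R) :
    Real.log R - Real.log T ≤ ∑ t ∈ Finset.Ico T R, 1 / (t : ℝ) := by
  rw [← Finset.sum_Ico_sub (fun t : ℕ => Real.log t) hTR]
  refine Finset.sum_le_sum fun t ht => ?_
  have ht1 : (0 : ℝ) < t := by
    have := (Finset.mem_Ico.1 ht).1
    exact_mod_cast (by omega : 0 < t)
  rw [← Real.log_div (by positivity) ht1.ne']
  refine (Real.log_le_sub_one_of_pos (by positivity)).trans (le_of_eq ?_)
  push_cast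
  field_simp
  ring

/-- The majority side uses the harmonic grid from `g ^ 2` to `g ^ 3`: its total weight is at least
`log g`, and starting at `g ^ 2` permits any truncation `V ≤ g ^ 2`. The constant 72 is `4 * 18`,
and 1152 comes from `16 (2 V + 1) * 24 ≤ 1152 V`. -/
theorem pow_le_dns_conj_maj {ι : Type*} [Fintype ι] {B : Type*} [Fintype B] [DecidableEq B]
    {h : BoolFun ι} {f : BoolFun B} {n q d g V : ℕ} (hl : IsLift h f)
    (hr : Resolves f q {t : ℤ | t ≠ 0 ∧ |t| < 2 ^ q}) (hg : 2 ≤ g) (hgn : g ^ 3 ≤ n / 4 / 2)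
    (hV : 1 ≤ V) (hVg : V ≤ g ^ 2) (hVd : 72 * (d : ℝ) ≤ V * Real.log g)
    (hq : 1152 * V * d < q) : 2 ^ d ≤ dns (conj h (maj n)) := by
  by_contra! hlt
  obtain ⟨p, hp, hs⟩ := exists_lowDeg_signRep_of_dns_lt (hl.conj (isLift_maj n)) hlt
  have hq' : (1152 * V * d : ℝ) < q := by exact_mod_cast hq
  have hV' : (1 : ℝ) ≤ V := by exact_mod_cast hV
  have hd0 : (0 : ℝ) ≤ d := by positivity
  have hdq : d ≤ q := by nlinarith
  have hg0 : (1 : ℝ) < g := by exact_mod_cast (by omega : 1 < g)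
  have hlog : 0 < Real.log g := Real.log_pos hg0
  have hTR : g ^ 2 ≤ g ^ 3 := Nat.pow_le_pow_right (by omega) (by norm_num)
  have hT : 1 ≤ g ^ 2 := Nat.one_le_pow _ _ (by omega)
  have hW : Real.log g ≤ ∑ t ∈ Finset.Ico (g ^ 2) (g ^ 3), 1 / (t : ℝ) := by
    have := log_le_sum_inv hT hTR
    push_cast at this
    rw [Real.log_pow, Real.log_pow] at this
    push_cast at this
    linarith
  have := card_le_of_signRep_conj hr (resolves_aboveLevel (Fin (n / 4)) ((n - 2 * (n / 4)) / 4) q) hdq hp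
    hs (Finset.range q) (fun i => 2 ^ i) (Finset.Ico (g ^ 2) (g ^ 3)) (fun t => (t : ℤ))
    (fun t => 1 / (t : ℝ)) (fun _ _ => by positivity) (hlog.trans_le hW)
    (fun i hi => pow_two_mem_grid hi) (fun t ht => by
      obtain ⟨h1, h2⟩ := Finset.mem_Ico.1 ht
      simp only [Set.mem_ofPred_eq, Fintype.card_fin]
      omega)
    (E := 24) (E' := 18) hV (by norm_num) (by norm_num) (sum_logDist_geometric_int q)
    (fun r hr => by
      have := sum_logDist_harmonic hT hTR (V := V) (by positivity) (by exact_mod_cast hVg) hr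
      simpa using this)
    (by nlinarith)
  rw [Finset.card_range] at this
  nlinarith

/-! ### Choice of parameters and conclusion -/

theorem exists_hard_halfspace (n : ℕ) (hn : 1 ≤ n) : ∃ h : BoolFun (Fin n), IsHalfspace h ∧
    (∃ x, h x = -1) ∧ (∃ x, h x = 1) ∧
    (512 ≤ n → ∃ f : BoolFun (Fin (64 * (n / 512)) ⊕ Fin (64 * (n / 512))), IsLift h f ∧
      Resolves f (n / 512) {t : ℤ | t ≠ 0 ∧ |t| < 2 ^ (n / 512)}) := by
  by_cases hn2 : 512 ≤ n
  · set q := n / 512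
    have hq : 1 ≤ q := by omega
    obtain ⟨w, hw⟩ := exists_fooling_weights (ι := Fin (64 * q)) hq (by simp)
    have hres := resolves_carry (Y := Fin (64 * q)) rfl w hw
    obtain ⟨e⟩ : Nonempty ((Fin (64 * q) ⊕ Fin (64 * q)) × Bool × Bool ↪ Fin n) :=
      Function.Embedding.nonempty_of_card_le (by simp; omega)
    set W : Fin (64 * q) ⊕ Fin (64 * q) → ℤ := carryWeights w
    have hl := isLift_intHalfspace e W
    have hval : ∀ t : ℤ, t ≠ 0 → |t| < 2 ^ q →
        ∃ x, intHalfspace (Function.extend e (fun q => W q.1) 0) (∑ i, W i) x = if t < 0 then -1 else 1 := by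
      intro t ht0 ht
      obtain ⟨ν, hν, _⟩ := hres
      obtain ⟨_, h1, h2⟩ := hν t ⟨ht0, ht⟩
      obtain ⟨b, hb⟩ : ∃ b, ν t b ≠ 0 := by
        by_contra! h
        simp [h] at h1
      obtain ⟨e', c, hl⟩ := hl
      exact ⟨_, (hl (fun _ => false) (fun _ => false) b).trans (h2 b hb)⟩
    have hlt : (1 : ℤ) < 2 ^ q := one_lt_pow₀ (by norm_num) (by omega)
    exact ⟨_, isHalfspace_intHalfspace _ _, by simpa using hval (-1) (by norm_num) (by simpa using hlt),
      by simpa using hval 1 (by norm_num) (by simpa using hlt), fun _ => ⟨_, hl, hres⟩⟩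
  -- For small `n` any nonconstant halfspace will do; this one is the disjunction.
  · refine ⟨intHalfspace (fun _ => -1) (-1), isHalfspace_intHalfspace _ _,
      ⟨fun _ => true, ?_⟩, ⟨fun _ => false, ?_⟩, fun h => absurd h hn2⟩
    · simp only [intHalfspace, intForm]
      simp
      omega
    · simp [intHalfspace, intForm]

lemma exists_cube_root (N : ℕ) : ∃ g : ℕ, g ^ 3 ≤ N ∧ N < (g + 1) ^ 3 := by
  induction N with
  | zero => exact ⟨0, by norm_num, by norm_num⟩
  | succ N ih =>
    obtain ⟨g, h1, h2⟩ := ih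
    by_cases h : (g + 1) ^ 3 ≤ N + 1
    · refine ⟨g + 1, h, ?_⟩
      have : (g + 1) ^ 3 < (g + 1 + 1) ^ 3 := Nat.pow_lt_pow_left (by omega) (by norm_num)
      omega
    · exact ⟨g, by omega, by omega⟩

lemma exp_le_two_pow {x : ℝ} {d : ℕ} (h : x ≤ d * (1 / 2)) : Real.exp x ≤ 2 ^ d := by
  have h2 : (1 / 2 : ℝ) ≤ Real.log 2 := by linarith [Real.log_two_gt_d9]
  rw [← Real.exp_log (by norm_num : (0 : ℝ) < 2), ← Real.exp_nat_mul, Real.exp_le_exp]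
  have : (0 : ℝ) ≤ d := by positivity
  nlinarith

lemma sqrt_mul_logb_le (n : ℕ) : √((n : ℝ) * Real.logb 2 n) ≤ 2 * n := by
  have hn : (0 : ℝ) ≤ n := by positivity
  rw [Real.sqrt_le_left (by positivity)]
  have h2 : (1 / 2 : ℝ) ≤ Real.log 2 := by linarith [Real.log_two_gt_d9]
  have h3 : Real.log n ≤ n := by
    rcases hn.eq_or_lt with h | h
    · rw [← h]; simp
    · linarith [Real.log_le_sub_one_of_pos h]
  have h4 : Real.logb 2 n ≤ 2 * n := by
    rw [Real.logb, div_le_iff₀ (by linarith)]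
    nlinarith
  nlinarith

/-- `V` is `72 d / log g` rounded up. Then `V d` is about `72 d ^ 2 / log g`, which the bound on `d
^ 2` makes a small multiple of `q`; the rounding error costs one more `d`, which is at most `q / 10
^ 4`. -/
lemma exists_truncation {q g d : ℕ} (hg : 4 ≤ g) (hd : 1 ≤ d) (hqg : q ≤ g ^ 3)
    (hlq : Real.log g ≤ q) (hd2 : (d : ℝ) ^ 2 ≤ q * Real.log g / 10 ^ 8) :
    ∃ V : ℕ, 1 ≤ V ∧ V ≤ g ^ 2 ∧ 72 * (d : ℝ) ≤ V * Real.log g ∧ 1152 * V * d < q := by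
  have hgR : (4 : ℝ) ≤ g := by exact_mod_cast hg
  have hqgR : (q : ℝ) ≤ g ^ 3 := by exact_mod_cast hqg
  have hl1 : 1 ≤ Real.log g := by
    have h1 : Real.log (2 ^ 2) ≤ Real.log g := Real.log_le_log (by norm_num) (by linarith)
    rw [Real.log_pow] at h1
    push_cast at h1
    linarith [Real.log_two_gt_d9]
  set l := Real.log g
  have hl0 : 0 < l := by linarith
  have hq0 : (0 : ℝ) < q := by linarith
  have hd1 : (1 : ℝ) ≤ d := by exact_mod_cast hd
  have hdq : (d : ℝ) * 10 ^ 4 ≤ q := by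
    refine (pow_le_pow_iff_left₀ (by positivity) (by positivity) two_ne_zero).1 ?_
    have : (q : ℝ) * l ≤ q * q := mul_le_mul_of_nonneg_left hlq hq0.le
    rw [mul_pow, sq (q : ℝ)]
    linarith
  have hV2 : ((⌈72 * (d : ℝ) / l⌉₊ : ℝ) - 1) * l < 72 * d := by
    rw [← lt_div_iff₀ hl0]
    have := Nat.ceil_lt_add_one (by positivity : 0 ≤ 72 * (d : ℝ) / l)
    linarith
  refine ⟨⌈72 * (d : ℝ) / l⌉₊, Nat.one_le_ceil_iff.2 (by positivity), ?_, ?_, ?_⟩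
  · by_contra! hlt
    have hlt' : (g : ℝ) ^ 2 ≤ (⌈72 * (d : ℝ) / l⌉₊ : ℝ) - 1 := by
      have : ((g ^ 2 + 1 : ℕ) : ℝ) ≤ (⌈72 * (d : ℝ) / l⌉₊ : ℝ) := Nat.cast_le.2 hlt
      push_cast at this
      linarith
    have h1 : (g : ℝ) ^ 2 * l < 72 * d :=
      (mul_le_mul_of_nonneg_right hlt' hl0.le).trans_lt hV2
    have h2 : ((g : ℝ) ^ 2 * l) ^ 2 < (72 * d) ^ 2 := pow_lt_pow_left₀ h1 (by positivity) two_ne_zero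
    have h3 : (q : ℝ) * l ≤ g ^ 3 * l := mul_le_mul_of_nonneg_right hqgR hl0.le
    have h4 : (g : ℝ) ^ 3 * l ≤ ((g : ℝ) ^ 2 * l) ^ 2 := by
      have : (1 : ℝ) ≤ g * l := by nlinarith
      calc (g : ℝ) ^ 3 * l ≤ g ^ 3 * l * (g * l) := le_mul_of_one_le_right (by positivity) this
        _ = _ := by ring
    have h5 : 0 < (g : ℝ) ^ 3 * l := by positivity
    rw [mul_pow 72] at h2
    linarith
  · rw [← div_le_iff₀ hl0]
    exact Nat.le_ceil _
  · set V := ⌈72 * (d : ℝ) / l⌉₊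
    have h1 : ((V : ℝ) - 1) * l * d ≤ 72 * d * d :=
      mul_le_mul_of_nonneg_right hV2.le (by linarith)
    have h2 : ((V : ℝ) - 1) * d * l ≤ q / 10 ^ 6 * l := by
      have : 0 < (q : ℝ) * l := by positivity
      linarith
    have h3 := le_of_mul_le_mul_right h2 hl0
    have : (1152 * V * d : ℝ) < q := by linarith
    exact_mod_cast this

theorem exp_le_dns_conj_maj {ι : Type*} [Fintype ι] {B : Type*} [Fintype B] [DecidableEq B]
    {h : BoolFun ι} {f : BoolFun B} {n : ℕ} (hl : IsLift h f)
    (hr : Resolves f (n / 512) {t : ℤ | t ≠ 0 ∧ |t| < 2 ^ (n / 512)}) (hn : 10 ^ 14 ≤ n) :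
    Real.exp (1 / 10 ^ 16 * √((n : ℝ) * Real.logb 2 n)) ≤ dns (conj h (maj n)) := by
  set q := n / 512
  obtain ⟨g, hg1, hg2⟩ := exists_cube_root (n / 4 / 2)
  have hg100 : 1000 ≤ g := by
    by_contra! hlt
    have : (g + 1) ^ 3 ≤ 1000 ^ 3 := Nat.pow_le_pow_left (by omega) 3
    omega
  have h8 : (g + 1) ^ 3 ≤ 2 * g ^ 3 := by nlinarith [sq_nonneg g]
  have hng : n ≤ 16 * g ^ 3 := by omega
  have hqg : q ≤ g ^ 3 := by omega
  have hqn : n ≤ 1024 * q := by omega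
  have hgq : g ≤ q := by
    have : g ^ 3 ≤ 128 * q := by omega
    nlinarith [Nat.mul_le_mul hg100 hg100]
  have hn6 : n ≤ g ^ 6 := by
    have : 16 ≤ g ^ 3 := by nlinarith [Nat.pow_le_pow_left hg100 3]
    calc n ≤ 16 * g ^ 3 := hng
      _ ≤ g ^ 3 * g ^ 3 := Nat.mul_le_mul_right _ this
      _ = g ^ 6 := by ring
  have hnR : (10 : ℝ) ^ 14 ≤ n := by exact_mod_cast hn
  have hgR : (1000 : ℝ) ≤ g := by exact_mod_cast hg100
  have hqR : (n : ℝ) ≤ 1024 * q := by exact_mod_cast hqn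
  have hgqR : (g : ℝ) ≤ q := by exact_mod_cast hgq
  have hqgR : (q : ℝ) ≤ g ^ 3 := by exact_mod_cast hqg
  set l := Real.log g
  have hl2 : (1 / 2 : ℝ) ≤ Real.log 2 := by linarith [Real.log_two_gt_d9]
  have hl1 : 1 ≤ l := by
    have h1 : Real.log (2 ^ 2) ≤ l := Real.log_le_log (by norm_num) (by linarith)
    rw [Real.log_pow] at h1
    push_cast at h1
    linarith
  have hlg : l ≤ g := by linarith [Real.log_le_sub_one_of_pos (by linarith : (0 : ℝ) < g)]
  have hlogn : Real.logb 2 n ≤ 12 * l := by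
    have h1 : Real.log n ≤ Real.log ((g : ℝ) ^ 6) :=
      Real.log_le_log (by linarith) (by exact_mod_cast hn6)
    rw [Real.log_pow] at h1
    push_cast at h1
    rw [Real.logb, div_le_iff₀ (by linarith)]
    nlinarith
  -- The largest degree that `exists_truncation` allows, before rounding down. As `log n` and `log
  -- g` are comparable, `y` is of order `√(n log n)`.
  set y := √((q : ℝ) * l / 10 ^ 8)
  have hy2 : y ^ 2 = (q : ℝ) * l / 10 ^ 8 := Real.sq_sqrt (by positivity)
  have hy1 : 1 ≤ y := by
    rw [Real.one_le_sqrt, le_div_iff₀ (by norm_num)]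
    nlinarith
  set d := ⌊y⌋₊
  have hdy : (d : ℝ) ≤ y := Nat.floor_le (by linarith)
  have hdy' : y < d + 1 := Nat.lt_floor_add_one y
  have hd1 : 1 ≤ d := Nat.le_floor (by simpa using hy1)
  have hd1R : (1 : ℝ) ≤ d := by exact_mod_cast hd1
  have hd2 : (d : ℝ) ^ 2 ≤ q * l / 10 ^ 8 := by
    rw [← hy2]; exact pow_le_pow_left₀ (by linarith) hdy 2
  obtain ⟨V, hVpos, hVg, hV1, hqV⟩ := exists_truncation (by omega) hd1 hqg (by linarith) hd2
  have hdns := pow_le_dns_conj_maj hl hr (by omega : 2 ≤ g) hg1 hVpos hVg hV1 hqV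
  have hdns' : (2 : ℝ) ^ d ≤ dns (conj h (maj n)) := by exact_mod_cast hdns
  refine (exp_le_two_pow ?_).trans hdns'
  have hsq : √((n : ℝ) * Real.logb 2 n) ≤ 10 ^ 8 * y := by
    rw [Real.sqrt_le_left (by positivity), mul_pow, hy2]
    have h1 : (n : ℝ) * Real.logb 2 n ≤ (1024 * q) * (12 * l) := by
      gcongr
      exact Real.logb_nonneg (by norm_num) (by linarith)
    have : 0 ≤ (q : ℝ) * l := by positivity
    linarith
  linarith

end ThresholdDensity

open ThresholdDensity

theorem theorem6p4 :
    ∃ h : (n : ℕ) → ThresholdDensity.BoolFun (Fin n),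
      (∀ n : ℕ, 1 ≤ n → ThresholdDensity.IsHalfspace (h n)) ∧
      (∃ c : ℝ, 0 < c ∧ ∀ n : ℕ, 1 ≤ n →
        Real.exp (c * (n : ℝ)) ≤
          (ThresholdDensity.dns (ThresholdDensity.conj (h n) (h n)) : ℝ)) ∧
      (∃ c : ℝ, 0 < c ∧ ∀ n : ℕ, 1 ≤ n →
        Real.exp (c * Real.sqrt ((n : ℝ) * Real.logb 2 (n : ℝ))) ≤
          (ThresholdDensity.dns
            (ThresholdDensity.conj (h n) (ThresholdDensity.maj n)) : ℝ)) := by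
  have hex : ∀ n : ℕ, ∃ h : BoolFun (Fin n), 1 ≤ n → IsHalfspace h ∧
      (∃ x, h x = -1) ∧ (∃ x, h x = 1) ∧
      (512 ≤ n → ∃ f : BoolFun (Fin (64 * (n / 512)) ⊕ Fin (64 * (n / 512))), IsLift h f ∧
        Resolves f (n / 512) {t : ℤ | t ≠ 0 ∧ |t| < 2 ^ (n / 512)}) := by
    intro n
    by_cases hn : 1 ≤ n
    · obtain ⟨h, hh⟩ := exists_hard_halfspace n hn
      exact ⟨h, fun _ => hh⟩
    · exact ⟨fun _ => 1, fun h => absurd h hn⟩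
  choose h hh using hex
  refine ⟨h, fun n hn => (hh n hn).1, ⟨1 / 10 ^ 8, by norm_num, fun n hn => ?_⟩,
    ⟨1 / 10 ^ 16, by norm_num, fun n hn => ?_⟩⟩
  · obtain ⟨_, ht, hf, hlift⟩ := hh n hn
    by_cases hbig : 10 ^ 7 ≤ n
    · obtain ⟨f, hl, hr⟩ := hlift (by omega)
      have hd := pow_le_dns_conj_self hl hr (d := (n / 512 - 1) / 1152) (by omega)
      have hd' : (2 : ℝ) ^ ((n / 512 - 1) / 1152) ≤ dns (conj (h n) (h n)) := by exact_mod_cast hd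
      refine (exp_le_two_pow ?_).trans hd'
      have : n ≤ 10 ^ 7 * ((n / 512 - 1) / 1152) := by omega
      have : (n : ℝ) ≤ 10 ^ 7 * ((n / 512 - 1) / 1152 : ℕ) := by exact_mod_cast this
      nlinarith
    -- Below the cutoff the constant is small enough that the exponential is at most 2, and
    -- nonconstancy alone gives density at least 2.
    · have h2 : (2 : ℝ) ≤ dns (conj (h n) (h n)) := by
        exact_mod_cast two_le_dns_conj _ _ ht hf ht hf
      refine le_trans ?_ h2
      have hnR : (n : ℝ) ≤ 10 ^ 7 := by exact_mod_cast (not_le.1 hbig).le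
      have := exp_le_two_pow (x := 1 / 10 ^ 8 * (n : ℝ)) (d := 1) (by rw [Nat.cast_one]; linarith)
      simpa using this
  · obtain ⟨_, ht, hf, hlift⟩ := hh n hn
    by_cases hbig : 10 ^ 14 ≤ n
    · obtain ⟨f, hl, hr⟩ := hlift (by omega)
      exact exp_le_dns_conj_maj hl hr hbig
    · have hm : ∃ x, maj n x = -1 := ⟨fun _ => true, by
        have : (0 : ℝ) < n := by exact_mod_cast hn
        simp [maj, bit]; linarith⟩
      have hm' : ∃ x, maj n x = 1 := ⟨fun _ => false, by simp [maj, bit]; positivity⟩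
      have h2 : (2 : ℝ) ≤ dns (conj (h n) (maj n)) := by
        exact_mod_cast two_le_dns_conj _ _ ht hf hm hm'
      refine le_trans ?_ h2
      have hnR : (n : ℝ) ≤ 10 ^ 14 := by exact_mod_cast (not_le.1 hbig).le
      have hs := sqrt_mul_logb_le n
      have := exp_le_two_pow (x := 1 / 10 ^ 16 * √((n : ℝ) * Real.logb 2 n)) (d := 1)
        (by rw [Nat.cast_one]; linarith)
      simpa using this

end
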